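/- Let $T\ge 1$ be an integer, $p\ge 1$, $s\in(0,1)$ with $sp<1$. A ($T$-periodic) configuration $\mathbf X\in\mathbb X_T$ is given by points $0\le x_1\le\dots\le x_T<T$, extended periodically to the points $x_i+kT$, $k\in\mathbb Z$, counted with multiplicity. Let $\mathbb X_T^0\subset\mathbb X_T$ be the set of configurations in which the points $x_i + kT$ are pairwise distinct. For $\mathbf X\in\mathbb X_T$ let $u=u[\mathbf X]$ be the $T$-periodic function, unique up to an additive constant, with distributional derivative $\mathrm Du=\mathcal L^1-\sum_{k\in\mathbb Z}\sum_{i=1}^T\delta_{x_i+kT}$, and set $$\mathcal F^s_p[\mathbf X]=\int_0^T\int_{\mathbb R}\frac{|u(x)-u(y)|^p}{|x-y|^{1+sp}}\,\mathrm dy\,\mathrm dx .$$ Let $\mathbf X^{\mathrm{eq}}$ be the equispaced configuration, whose points are the integers. For $\mathbf X\in\mathbb X_T$ and $h\in\mathbb R$ let $\mathbf X+he_i$ be the configuration obtained by moving $x_i$ (and its translates $x_i+kT$) by $h$. We call $\mathbf X$ critical if for every $i=1,\dots,T$ the function $h\mapsto\mathcal F^s_p[\mathbf X+he_i]$ is differentiable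 at $h=0$ with derivative $0$. We call $\mathbf X$ a local minimiser if there is $\varepsilon>0$ such that $\mathcal F^s_p[\mathbf X]\le\mathcal F^s_p[\mathbf Y]$ for every $\mathbf Y\in\mathbb X_T$ whose points can be matched with those of $\mathbf X$ modulo $T$ at distances less than $\varepsilon$, and a global minimiser if $\mathcal F^s_p[\mathbf X]\le\mathcal F^s_p[\mathbf Y]$ for all $\mathbf Y\in\mathbb X_T$. Then $\mathcal F^s_p$ is finite on all configurations, and: (1) $\mathbf X^{\mathrm{eq}}$ is, up to translation, the unique critical point of $\mathcal F^s_p$ in $\mathbb X^0_T$: a configuration $\mathbf X\in\mathbb X_T$ belongs to $\mathbb X_T^0$ and is critical if and only if $\mathbf X=\mathbf X^{\mathrm{eq}}+a$ for some $a\in\mathbb R$. (2) $\mathbf X^{\mathrm{eq}}$ is, up to translation, the unique local and the unique global minimiser of $\mathcal F^s_p$ in $\mathbb X_T$: a configuration $\mathbf X\in\mathbb X_T$ is a local minimiser if and only if $\mathbf X=\mathbf X^{\mathrm{eq}}+a$ for some $a\in\mathbb R$, and it is a global minimiser if and only if $\mathbf X=\mathbf X^{\mathrm{eq}}+a$ for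 some $a\in\mathbb R$. -/

import Mathlib

open MeasureTheory Set
open scoped ENNReal ContDiff

noncomputable section

/-- The one-dimensional energy `F^s_p(u) = ∫_{[0,T]} ∫_ℝ |u(x) - u(y)|^p / |x - y|^(1 + s p) dy dx`
of a `T`-periodic function `u`, with values in `[0, ∞]`. -/
def gagliardoEnergy (T : ℕ) (s p : ℝ) (u : ℝ → ℝ) : ℝ≥0∞ :=
  ∫⁻ x in Icc (0 : ℝ) T, ∫⁻ y : ℝ, ENNReal.ofReal (|u x - u y| ^ p / |x - y| ^ (1 + s * p))

/-- The function `u[x]` with slope `1` and one unit negative jump at every point `x i + k T`, where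
`i : Fin T` and `k : ℤ`; the additive constant is immaterial. The positions `x i` are arbitrary real
numbers, repetitions are allowed. See `jumpProfile_periodic` and `jumpProfile_hasJumpDerivative`. -/
def jumpProfile (T : ℕ) (x : Fin T → ℝ) (y : ℝ) : ℝ :=
  y - ∑ i, (⌊(y - x i) / T⌋ : ℝ)

/-- The identity `Du = ℒ¹ - ∑_{k ∈ ℤ} ∑_i δ_{x i + k T}` in the sense of distributions on `ℝ`. -/
def HasJumpDerivative (T : ℕ) (x : Fin T → ℝ) (u : ℝ → ℝ) : Prop :=
  LocallyIntegrable u ∧ ∀ φ : ℝ → ℝ, ContDiff ℝ ∞ φ → HasCompactSupport φ →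
    -∫ y, u y * deriv φ y = (∫ y, φ y) - ∑' k : ℤ, ∑ i, φ (x i + k * T)

theorem jumpProfile_periodic {T : ℕ} (hT : 0 < T) (x : Fin T → ℝ) :
    Function.Periodic (jumpProfile T x) T := by
  intro y
  have hT' : (T : ℝ) ≠ 0 := by positivity
  have h : ∀ i, ⌊(y + T - x i) / T⌋ = ⌊(y - x i) / T⌋ + 1 := by
    intro i
    rw [← Int.floor_add_one]
    congr 1
    field_simp
    ring
  simp only [jumpProfile, h]
  push_cast
  rw [Finset.sum_add_distrib]
  simp

theorem locallyIntegrable_floor_div {T : ℕ} (a : ℝ) :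
    LocallyIntegrable (fun y : ℝ => (⌊(y - a) / T⌋ : ℝ)) := by
  have h : Monotone (fun y : ℝ => (⌊(y - a) / T⌋ : ℝ)) := by
    intro y z hyz
    have : ⌊(y - a) / (T : ℝ)⌋ ≤ ⌊(z - a) / (T : ℝ)⌋ := by gcongr
    exact Int.cast_le.2 this
  exact h.locallyIntegrable

theorem integral_floor_div_mul_deriv {T : ℕ} (hT : 0 < T) (a : ℝ) {φ : ℝ → ℝ}
    (hφ : ContDiff ℝ ∞ φ) (hc : HasCompactSupport φ) :
    Summable (fun k : ℤ => φ (a + k * T)) ∧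
    ∫ y, (⌊(y - a) / T⌋ : ℝ) * deriv φ y = -∑' k : ℤ, φ (a + k * T) := by
  have hT' : (0 : ℝ) < T := by exact_mod_cast hT
  obtain ⟨R, hR⟩ : ∃ R : ℝ, ∀ y, R ≤ |y - a| → φ y = 0 ∧ deriv φ y = 0 := by
    obtain ⟨R, hR⟩ := hc.isCompact.isBounded.subset_ball a
    refine ⟨R, fun y hy => ?_⟩
    have hy' : y ∉ tsupport φ := fun h => by
      have := hR h
      rw [Metric.mem_ball, Real.dist_eq] at this
      linarith
    exact ⟨image_eq_zero_of_notMem_tsupport hy',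
      image_eq_zero_of_notMem_tsupport (fun h => hy' (tsupport_deriv_subset h))⟩
  obtain ⟨N, hN⟩ := exists_nat_gt (R / T)
  have hN' : R < N * T := by rwa [div_lt_iff₀ hT'] at hN
  have hzero : ∀ k : ℤ, k ∉ Finset.Ico (-(N : ℤ)) N → φ (a + k * T) = 0 := by
    intro k hk
    refine (hR _ ?_).1
    have : (N : ℤ) ≤ |k| := by
      rw [Finset.mem_Ico] at hk
      rcases le_abs.2 (show (N : ℤ) ≤ k ∨ (N : ℤ) ≤ -k by omega) |>.lt_or_eq with h | h <;> omega
    have h2 : (N : ℝ) ≤ |(k : ℝ)| := by exact_mod_cast this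
    have h3 : |a + k * T - a| = |(k : ℝ)| * T := by
      rw [add_sub_cancel_left, abs_mul, abs_of_pos hT']
    rw [h3]
    nlinarith
  refine ⟨summable_of_ne_finset_zero (s := Finset.Ico (-(N : ℤ)) N) (fun k hk => hzero k hk), ?_⟩
  rw [tsum_eq_sum (s := Finset.Ico (-(N : ℤ)) N) (fun k hk => hzero k hk)]
  set f : ℝ → ℝ := fun y => (⌊(y - a) / T⌋ : ℝ) * deriv φ y with hf
  have hcd : Continuous (deriv φ) := hφ.continuous_deriv (by simp)
  have hfint : Integrable f :=
    (locallyIntegrable_floor_div a).integrable_smul_right_of_hasCompactSupport hcd hc.deriv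
  let c : ℕ → ℝ := fun n => a + ((n : ℝ) - N) * T
  have hcle : ∀ n, c n ≤ c (n + 1) := by
    intro n
    simp only [c]
    push_cast
    nlinarith
  have h1 : ∫ y, f y = ∫ y in (c 0)..(c (2 * N)), f y := by
    symm
    apply intervalIntegral.integral_eq_integral_of_support_subset
    intro y hy
    by_contra hcon
    apply hy
    have : R ≤ |y - a| := by
      simp only [c, mem_Ioc, not_and_or, not_lt, not_le] at hcon
      push_cast at hcon
      rcases hcon with h | h
      · have := neg_le_abs (y - a)
        nlinarith
      · have := le_abs_self (y - a)
        nlinarith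
    simp [hf, (hR y this).2]
  have h2 : ∫ y in (c 0)..(c (2 * N)), f y
      = ∑ n ∈ Finset.range (2 * N), ((n : ℝ) - N) * (φ (c (n + 1)) - φ (c n)) := by
    rw [← intervalIntegral.sum_integral_adjacent_intervals
      (fun k _ => hfint.intervalIntegrable)]
    refine Finset.sum_congr rfl fun n _ => ?_
    rw [← intervalIntegral.integral_deriv_eq_sub' φ rfl
      (fun y _ => (hφ.differentiable (by simp)).differentiableAt) hcd.continuousOn,
      ← intervalIntegral.integral_const_mul]
    rw [intervalIntegral.integral_of_le (hcle n), intervalIntegral.integral_of_le (hcle n),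
      ← integral_Ico_eq_integral_Ioc, ← integral_Ico_eq_integral_Ioc]
    refine setIntegral_congr_fun measurableSet_Ico fun y hy => ?_
    have hfl : ⌊(y - a) / (T : ℝ)⌋ = (n : ℤ) - N := by
      rw [Int.floor_eq_iff]
      simp only [c, mem_Ico] at hy
      push_cast at hy ⊢
      constructor
      · rw [le_div_iff₀ hT']; linarith
      · rw [div_lt_iff₀ hT']; linarith
    simp only [hf, hfl]
    push_cast
    ring
  have h3 : ∀ m : ℕ, ∑ n ∈ Finset.range m, ((n : ℝ) - N) * (φ (c (n + 1)) - φ (c n))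
      = ((m : ℝ) - N) * φ (c m) + N * φ (c 0) - ∑ n ∈ Finset.range m, φ (c (n + 1)) := by
    intro m
    induction m with
    | zero => simp
    | succ m ih =>
      rw [Finset.sum_range_succ, ih, Finset.sum_range_succ]
      push_cast
      ring
  have hc0 : φ (c 0) = 0 := (hR _ (by
    simp only [c]
    rw [add_sub_cancel_left, abs_mul, abs_of_pos hT']
    simp only [Nat.cast_zero, zero_sub, abs_neg, Nat.abs_cast]
    exact hN'.le)).1
  have hc2 : φ (c (2 * N)) = 0 := (hR _ (by
    simp only [c]
    push_cast
    rw [add_sub_cancel_left, abs_mul, abs_of_pos hT', show (2 : ℝ) * N - N = N by ring,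
      Nat.abs_cast]
    exact hN'.le)).1
  have h4 : ∑ n ∈ Finset.range (2 * N), φ (c (n + 1)) = ∑ n ∈ Finset.range (2 * N), φ (c n) := by
    have := Finset.sum_range_succ (fun n => φ (c n)) (2 * N)
    rw [Finset.sum_range_succ', hc0, hc2] at this
    linarith
  have h5 : ∑ k ∈ Finset.Ico (-(N : ℤ)) N, φ (a + k * T)
      = ∑ n ∈ Finset.range (2 * N), φ (c n) := by
    symm
    refine Finset.sum_bij (fun n _ => (n : ℤ) - N) ?_ ?_ ?_ ?_
    · intro n hn
      simp only [Finset.mem_range, Finset.mem_Ico] at hn ⊢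
      omega
    · intro n _ m _ h
      omega
    · intro k hk
      simp only [Finset.mem_range, Finset.mem_Ico] at hk ⊢
      exact ⟨(k + N).toNat, by omega, by omega⟩
    · intro n _
      simp [c]
  rw [h1, h2, h3, hc0, hc2, h4, h5]
  ring

theorem jumpProfile_hasJumpDerivative {T : ℕ} (hT : 0 < T) (x : Fin T → ℝ) :
    HasJumpDerivative T x (jumpProfile T x) := by
  have hsum : LocallyIntegrable (fun y : ℝ => ∑ i, (⌊(y - x i) / T⌋ : ℝ)) :=
    locallyIntegrable_finsetSum _ fun i _ => locallyIntegrable_floor_div (x i)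
  have hidl : LocallyIntegrable (fun y : ℝ => y) := continuous_id.locallyIntegrable
  refine ⟨hidl.sub hsum, fun φ hφ hc => ?_⟩
  have hcd : Continuous (deriv φ) := hφ.continuous_deriv (by simp)
  have hfl : ∀ i, Integrable (fun y => (⌊(y - x i) / T⌋ : ℝ) * deriv φ y) := fun i =>
    (locallyIntegrable_floor_div (x i)).integrable_smul_right_of_hasCompactSupport hcd hc.deriv
  have hid : Integrable (fun y : ℝ => y * deriv φ y) :=
    (continuous_id.mul hcd).integrable_of_hasCompactSupport hc.deriv.mul_left
  have hparts : ∫ y : ℝ, y * deriv φ y = -∫ y, φ y := by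
    have := integral_mul_deriv_eq_deriv_mul_of_integrable (u := fun y : ℝ => y) (v := φ)
      (u' := fun _ => 1) (v' := deriv φ) (fun y _ => hasDerivAt_id y)
      (fun y _ => ((hφ.differentiable (by simp)) y).hasDerivAt) hid
      (by simpa [Pi.mul_def] using hφ.continuous.integrable_of_hasCompactSupport (μ := volume) hc)
      ((continuous_id.mul hφ.continuous).integrable_of_hasCompactSupport hc.mul_left)
    simpa using this
  have hexp : (fun y => jumpProfile T x y * deriv φ y)
      = fun y => y * deriv φ y - ∑ i, (⌊(y - x i) / T⌋ : ℝ) * deriv φ y := by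
    funext y
    rw [jumpProfile, sub_mul, Finset.sum_mul]
  rw [hexp, integral_sub hid (integrable_finsetSum _ fun i _ => hfl i),
    integral_finsetSum _ fun i _ => hfl i, hparts,
    Summable.tsum_finsetSum fun i _ => (integral_floor_div_mul_deriv hT (x i) hφ hc).1]
  simp only [fun i => (integral_floor_div_mul_deriv hT (x i) hφ hc).2, Finset.sum_neg_distrib]
  ring

/-- The energy of the `T`-periodic configuration of jumps `x i + k T`, as a function of the
positions `x i`. -/
def jumpEnergy (T : ℕ) (s p : ℝ) (x : Fin T → ℝ) : ℝ≥0∞ :=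
  gagliardoEnergy T s p (jumpProfile T x)

/-- A `T`-periodic configuration of `T` (possibly overlapping) jumps per period, given by its
points in `[0, T)` in nondecreasing order. It stands for the points `pts i + k T`, `k : ℤ`,
counted with multiplicity. -/
structure Config (T : ℕ) where
  pts : Fin T → ℝ
  mem_Ico : ∀ i, pts i ∈ Ico (0 : ℝ) T
  mono : Monotone pts

namespace Config

variable {T : ℕ}

/-- `F^s_p[X] = F^s_p(u[X])`. -/
def energy (s p : ℝ) (X : Config T) : ℝ≥0∞ := jumpEnergy T s p X.pts

/-- Any two points of the periodic configuration with different indices are at distance at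
least `l`. -/
def IsRegularWith (l : ℝ) (X : Config T) : Prop :=
  ∀ (i j : Fin T) (k : ℤ), (i ≠ j ∨ k ≠ 0) → l ≤ |X.pts i - (X.pts j + k * T)|

/-- Configurations with non-overlapping jumps. -/
def IsRegular (X : Config T) : Prop := ∃ l : ℝ, 0 < l ∧ l ≤ 1 ∧ X.IsRegularWith l

/-- `X + h e_i`: the point `x_i` and its translates by multiples of `T` are moved by `h`. Only the
positions are recorded here; they need not be sorted or lie in `[0, T)`. -/
def rigidVariation (X : Config T) (i : Fin T) (h : ℝ) : Fin T → ℝ :=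
  Function.update X.pts i (X.pts i + h)

/-- The first variation with respect to every rigid variation exists and vanishes:
`∂_{x_i} F^s_p[X] = 0` for all `i`. (The energy is finite when `s p < 1`.) -/
def IsCritical (s p : ℝ) (X : Config T) : Prop :=
  ∀ i, HasDerivAt (fun h : ℝ => (jumpEnergy T s p (X.rigidVariation i h)).toReal) 0 0

/-- `Y` is obtained from `X` by displacing every point by less than `ε`, where points are
identified modulo `T` and are not labelled. -/
def IsNear (ε : ℝ) (X Y : Config T) : Prop :=
  ∃ (σ : Equiv.Perm (Fin T)) (k : Fin T → ℤ), ∀ i, |Y.pts (σ i) + k i * T - X.pts i| < ε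

def IsLocalMinimiser (s p : ℝ) (X : Config T) : Prop :=
  ∃ ε : ℝ, 0 < ε ∧ ∀ Y : Config T, X.IsNear ε Y → X.energy s p ≤ Y.energy s p

def IsGlobalMinimiser (s p : ℝ) (X : Config T) : Prop :=
  ∀ Y : Config T, X.energy s p ≤ Y.energy s p

/-- `X = Y + a` for some `a : ℝ`, as periodic configurations: the points of both, counted with
multiplicity, agree modulo `T`. -/
def IsTranslateOf (X Y : Config T) : Prop :=
  ∃ (a : ℝ) (σ : Equiv.Perm (Fin T)) (k : Fin T → ℤ),
    ∀ i, X.pts (σ i) = Y.pts i + a + k i * T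

/-- The configuration with points `0, 1, …, T - 1` in `[0, T)`, that is, with jumps at all
integers. -/
def equispaced (T : ℕ) : Config T where
  pts i := ((i : ℕ) : ℝ)
  mem_Ico i := ⟨Nat.cast_nonneg _, Nat.cast_lt.2 i.isLt⟩
  mono _ _ h := Nat.cast_le.2 h

end Config

end

open Filter Topology

noncomputable section

/-! Write the energy as an integral over increments `z > 0`. Since `u` has slope one and unit jumps,
`u (y + z) - u y = z - N`, where `N` is the number of points in `(y, y + z]`. As a function of the
integer `N`, `|z - N| ^ p` is discretely convex: it is an affine function of `N` plus a combination
of the hinges `(N - k)⁺`, `k ≥ 1`, with nonnegative second differences as coefficients. Over one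
period `(N - k)⁺` integrates to the sum of `(z - (ξ (i + k) - ξ i))⁺`, a convex function of the gaps
of the ordered enumeration `ξ`, and the affine part integrates to a constant. So the energy is
convex on the convex set of ordered tuples (`convexOn_jumpEnergy`).

The `k`-step gaps have mean `k`, so Jensen's inequality makes the equispaced configuration minimal
for every `z`. If some one-step gap is below `1`, the inequality is strict for all `z` between that
gap and `1`, so minimisers have all gaps equal to `1` (`gap_eq_one_of_integral_le`).

By convexity, local minimisers are global (`IsLocalMinimiser.isGlobalMinimiser`), and so are
critical points at which every coordinate can move freely (`ConvexOn.le_of_partialDeriv_eq_zero`).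
Conversely, moving one equispaced point by `h` changes the integrand by `O(h)`, and only for `z`
within `|h|` of a positive integer, so the derivative vanishes (`hasDerivAt_jumpEnergy_update`). -/

/-- A nondecreasing enumeration of a `T`-periodic configuration with `T` points per period. -/
structure IsEnumeration (T : ℕ) (ξ : ℤ → ℝ) : Prop where
  mono : Monotone ξ
  add_period : ∀ n, ξ (n + T) = ξ n + T

/-- The points `x i + k T` are, with multiplicity, the points `ξ n`. -/
def Enumerates (T : ℕ) (ξ : ℤ → ℝ) (x : Fin T → ℝ) : Prop :=
  ∃ (σ : Equiv.Perm (Fin T)) (k : Fin T → ℤ), ∀ i, x (σ i) = ξ (i : ℕ) + k i * T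

/-- The largest `n` with `ξ n ≤ y`; see `IsEnumeration.le_lastIndex_iff`. -/
def lastIndex (T : ℕ) (ξ : ℤ → ℝ) (y : ℝ) : ℤ :=
  ∑ i ∈ Finset.range T, ⌊(y - ξ i) / T⌋ + T - 1

/-! ### Counting the points in a window, and integrating the hinges of the count. -/

namespace IsEnumeration

variable {T : ℕ} {ξ : ℤ → ℝ}

theorem add_mul_period (h : IsEnumeration T ξ) (n m : ℤ) : ξ (n + m * T) = ξ n + m * T := by
  induction m using Int.induction_on with
  | zero => simp
  | succ m ih =>
    have := h.add_period (n + m * T)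
    rw [ih] at this
    rw [show n + ((m : ℤ) + 1) * T = n + m * T + T by ring, this]
    push_cast; ring
  | pred m ih =>
    have := h.add_period (n + (-(m : ℤ) - 1) * T)
    rw [show n + (-(m : ℤ) - 1) * T + T = n + -(m : ℤ) * T by ring, ih] at this
    push_cast at this ⊢
    linarith

/-- Moving the window of `T` consecutive indices one step replaces `ξ n` by `ξ (n + T) = ξ n + T`,
which lowers the sum by one. -/
theorem sum_floor_shift (hT : 0 < T) (h : IsEnumeration T ξ) (y : ℝ) (n : ℤ) :
    ∑ i ∈ Finset.range T, ⌊(y - ξ (n + i)) / T⌋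
      = ∑ i ∈ Finset.range T, ⌊(y - ξ i) / T⌋ - n := by
  have hT' : (T : ℝ) ≠ 0 := by positivity
  have step : ∀ n : ℤ, ∑ i ∈ Finset.range T, ⌊(y - ξ (n + 1 + i)) / T⌋
      = ∑ i ∈ Finset.range T, ⌊(y - ξ (n + i)) / T⌋ - 1 := by
    intro n
    have h1 := Finset.sum_range_succ (fun i : ℕ => ⌊(y - ξ (n + i)) / T⌋) T
    rw [Finset.sum_range_succ', h.add_period] at h1
    have h2 : ⌊(y - (ξ n + T)) / T⌋ = ⌊(y - ξ n) / T⌋ - 1 := by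
      rw [← Int.floor_sub_one]
      congr 1
      field_simp
      ring
    rw [h2] at h1
    have h3 : ∀ i : ℕ, n + 1 + (i : ℤ) = n + ((i + 1 : ℕ) : ℤ) := by intro i; push_cast; ring
    simp only [h3]
    simp only [Nat.cast_zero, add_zero] at h1
    linarith
  induction n using Int.induction_on with
  | zero => simp
  | succ m ih => rw [step, ih]; ring
  | pred m ih =>
    have := step (-(m : ℤ) - 1)
    rw [show -(m : ℤ) - 1 + 1 = -m by ring, ih] at this
    linarith

/-- A window starting at `n` has only negative floors if `y < ξ n`; a window ending at `n` has only
nonnegative ones if `ξ n ≤ y`. The term `T - 1` in `lastIndex` is the offset between these two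
windows. -/
theorem le_lastIndex_iff (hT : 0 < T) (h : IsEnumeration T ξ) {y : ℝ} {n : ℤ} :
    n ≤ lastIndex T ξ y ↔ ξ n ≤ y := by
  have hT' : (0 : ℝ) < T := by exact_mod_cast hT
  constructor
  · intro hn
    by_contra! hy
    have h1 := h.sum_floor_shift hT y n
    have h2 : ∑ i ∈ Finset.range T, ⌊(y - ξ (n + i)) / T⌋ ≤ ∑ i ∈ Finset.range T, (-1 : ℤ) := by
      refine Finset.sum_le_sum fun i _ => ?_
      have : ⌊(y - ξ (n + i)) / T⌋ < 0 := by
        rw [Int.floor_lt, Int.cast_zero]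
        refine div_neg_of_neg_of_pos ?_ hT'
        have := h.mono (show n ≤ n + i by omega)
        linarith
      omega
    simp only [Finset.sum_const, Finset.card_range, nsmul_eq_mul] at h2
    unfold lastIndex at hn
    linarith
  · intro hy
    have h1 := h.sum_floor_shift hT y (n - T + 1)
    have h2 : 0 ≤ ∑ i ∈ Finset.range T, ⌊(y - ξ (n - T + 1 + i)) / T⌋ := by
      refine Finset.sum_nonneg fun i hi => ?_
      rw [Finset.mem_range] at hi
      have := h.mono (show n - T + 1 + i ≤ n by omega)
      exact Int.floor_nonneg.2 (div_nonneg (by linarith) hT'.le)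
    unfold lastIndex
    linarith

theorem monotone_lastIndex (hT : 0 < T) (h : IsEnumeration T ξ) : Monotone (lastIndex T ξ) :=
  fun _ _ hab => (h.le_lastIndex_iff hT).2 (((h.le_lastIndex_iff hT).1 le_rfl).trans hab)

/-- The integer on the right is the number of points of the configuration in `(y, y + z]`. -/
theorem _root_.Enumerates.sub_jumpProfile {x : Fin T → ℝ} (hx : Enumerates T ξ x) (hT : 0 < T)
    (y z : ℝ) :
    jumpProfile T x y - jumpProfile T x (y + z)
      = ((lastIndex T ξ (y + z) - lastIndex T ξ y : ℤ) : ℝ) - z := by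
  have hT' : (T : ℝ) ≠ 0 := by positivity
  obtain ⟨σ, k, hk⟩ := hx
  have key : ∀ y, jumpProfile T x y = y - (lastIndex T ξ y + 1 - T) + ∑ i, (k i : ℝ) := by
    intro y
    unfold jumpProfile lastIndex
    rw [← Equiv.sum_comp σ]
    have : ∀ i : Fin T, ⌊(y - x (σ i)) / T⌋ = ⌊(y - ξ (i : ℕ)) / T⌋ - k i := by
      intro i
      rw [← Int.floor_sub_intCast, hk]
      congr 1
      field_simp
      ring
    simp only [this]
    push_cast
    rw [Finset.sum_sub_distrib, ← Fin.sum_univ_eq_sum_range (fun i => (⌊(y - ξ i) / T⌋ : ℝ))]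
    ring
  rw [key, key]
  push_cast
  ring

/-- The `n`-th indicator is `1` exactly when all of `ξ n, …, ξ (n + k)` lie in `(y, y + z]`; a run
of `N` consecutive indices contains `(N - k)⁺` such starting points. -/
theorem tsum_indicator_Ico (hT : 0 < T) (h : IsEnumeration T ξ) (z : ℝ) (k : ℕ) (y : ℝ) :
    ∑' n : ℤ, (Ico (ξ (n + k) - z) (ξ n)).indicator (1 : ℝ → ℝ≥0∞) y
      = ENNReal.ofReal (max ((lastIndex T ξ (y + z) - lastIndex T ξ y : ℤ) - k : ℝ) 0) := by
  have hmem : ∀ n : ℤ, y ∈ Ico (ξ (n + k) - z) (ξ n)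
      ↔ n ∈ Finset.Ioc (lastIndex T ξ y) (lastIndex T ξ (y + z) - k) := by
    intro n
    rw [mem_Ico, Finset.mem_Ioc, le_sub_iff_add_le, h.le_lastIndex_iff hT,
      ← not_le (a := n), h.le_lastIndex_iff hT, not_le, sub_le_iff_le_add, and_comm]
  rw [tsum_eq_sum (s := Finset.Ioc (lastIndex T ξ y) (lastIndex T ξ (y + z) - k))]
  · rw [Finset.sum_congr rfl fun n hn => indicator_of_mem ((hmem n).2 hn) _]
    simp only [Pi.one_apply, Finset.sum_const, Int.card_Ioc, nsmul_eq_mul, mul_one]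
    rw [← ENNReal.ofReal_natCast]
    congr 1
    rw [← Int.cast_natCast, Int.ofNat_toNat]
    push_cast
    congr 1
    ring
  · intro n hn
    exact indicator_of_notMem (fun hy => hn ((hmem n).1 hy)) _

theorem measurable_lastIndex (hT : 0 < T) (h : IsEnumeration T ξ) :
    Measurable (fun y => (lastIndex T ξ y : ℝ)) :=
  Monotone.measurable fun _ _ hab => Int.cast_le.2 (h.monotone_lastIndex hT hab)

/-- The difference is a sum of `T` differences of fractional parts, each of modulus less than one.
-/
theorem abs_count_sub_le (hT : 0 < T) (ξ : ℤ → ℝ) (y z : ℝ) :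
    |z - ((lastIndex T ξ (y + z) - lastIndex T ξ y : ℤ) : ℝ)| ≤ T := by
  have hT' : (T : ℝ) ≠ 0 := by positivity
  have e : z - ((lastIndex T ξ (y + z) - lastIndex T ξ y : ℤ) : ℝ)
      = ∑ i ∈ Finset.range T, (Int.fract ((y + z - ξ i) / T) - Int.fract ((y - ξ i) / T)) := by
    unfold lastIndex Int.fract
    push_cast
    simp only [Finset.sum_sub_distrib, ← Finset.sum_div, Finset.sum_add_distrib,
      Finset.sum_const, Finset.card_range, nsmul_eq_mul]
    field_simp
    ring
  rw [e]
  calc _ ≤ ∑ i ∈ Finset.range T, |Int.fract ((y + z - ξ i) / T) - Int.fract ((y - ξ i) / T)| :=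
        Finset.abs_sum_le_sum_abs _ _
    _ ≤ ∑ i ∈ Finset.range T, (1 : ℝ) := by
        refine Finset.sum_le_sum fun i _ => ?_
        rw [abs_le]
        constructor <;> linarith [Int.fract_nonneg ((y + z - ξ i) / T),
          Int.fract_lt_one ((y + z - ξ i) / T), Int.fract_nonneg ((y - ξ i) / T),
          Int.fract_lt_one ((y - ξ i) / T)]
    _ = T := by simp

/-- Unfolding: translating the interval past one period is the same as cutting it by the tiles `[m
T, (m + 1) T)`. -/
theorem lintegral_tsum_translates (hT : 0 < T) (a b : ℝ) :
    ∑' m : ℤ, ∫⁻ y in Ico (0 : ℝ) T, (Ico (a + m * T) (b + m * T)).indicator 1 y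
      = ENNReal.ofReal (b - a) := by
  have hT' : (0 : ℝ) < T := by exact_mod_cast hT
  rw [← Real.volume_Ico, ← inter_univ (Ico a b), ← iUnion_Ico_add_zsmul hT' 0, inter_iUnion,
    measure_iUnion]
  · rw [← (Equiv.neg ℤ).tsum_eq]
    refine tsum_congr fun m => ?_
    rw [lintegral_indicator_one measurableSet_Ico, Measure.restrict_apply measurableSet_Ico,
      ← measure_preimage_add_right volume (-(m : ℝ) * T)]
    congr 1
    ext y
    simp only [mem_preimage, mem_inter_iff, mem_Ico, zsmul_eq_mul, Equiv.neg_apply]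
    push_cast
    constructor <;> rintro ⟨⟨_, _⟩, _, _⟩ <;> refine ⟨⟨?_, ?_⟩, ?_, ?_⟩ <;> linarith
  · intro i j hij
    exact (pairwise_disjoint_Ico_add_zsmul (0 : ℝ) (T : ℝ) hij).mono inter_subset_right
      inter_subset_right
  · intro i
    exact measurableSet_Ico.inter measurableSet_Ico

/-- Split the indices as `n = i + m T`. For fixed `i` the intervals of `tsum_indicator_Ico` are the
`T`-translates of one interval of length `z - (ξ (i + k) - ξ i)`, empty if this is negative. -/
theorem lintegral_count (hT : 0 < T) (h : IsEnumeration T ξ) (z : ℝ) (k : ℕ) :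
    ∫⁻ y in Ico (0 : ℝ) T, ENNReal.ofReal
        (max ((lastIndex T ξ (y + z) - lastIndex T ξ y : ℤ) - k : ℝ) 0)
      = ∑ i ∈ Finset.range T, ENNReal.ofReal (z - (ξ (i + k) - ξ i)) := by
  have : NeZero T := ⟨hT.ne'⟩
  simp only [← h.tsum_indicator_Ico hT]
  rw [lintegral_tsum fun n => (measurable_one.indicator measurableSet_Ico).aemeasurable,
    ← (Int.divModEquiv T).symm.tsum_eq, ENNReal.tsum_prod', ENNReal.tsum_comm, tsum_fintype,
    ← Fin.sum_univ_eq_sum_range (fun i => ENNReal.ofReal (z - (ξ (i + k) - ξ i)))]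
  refine Finset.sum_congr rfl fun i _ => ?_
  rw [show z - (ξ ((i : ℕ) + k) - ξ (i : ℕ)) = ξ (i : ℕ) - (ξ ((i : ℕ) + k) - z) by ring,
    ← lintegral_tsum_translates hT]
  refine tsum_congr fun m => ?_
  have e : (Int.divModEquiv T).symm (m, i) = (i : ℕ) + m * T := by
    simp [Int.divModEquiv, add_comm]
  rw [e, show ((i : ℕ) : ℤ) + m * T + k = ((i : ℕ) + k) + m * T by ring, h.add_mul_period,
    h.add_mul_period, add_sub_right_comm]

theorem measurable_count (hT : 0 < T) (h : IsEnumeration T ξ) (z : ℝ) :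
    Measurable (fun y => ((lastIndex T ξ (y + z) - lastIndex T ξ y : ℤ) : ℝ)) := by
  push_cast
  exact ((h.measurable_lastIndex hT).comp (measurable_id.add_const z)).sub
    (h.measurable_lastIndex hT)

theorem integrableOn_count (hT : 0 < T) (h : IsEnumeration T ξ) (z : ℝ) (k : ℕ) :
    IntegrableOn (fun y => max ((lastIndex T ξ (y + z) - lastIndex T ξ y : ℤ) - k : ℝ) 0)
      (Ico (0 : ℝ) T) := by
  refine ⟨(((h.measurable_count hT z).sub_const _).max measurable_const).aestronglyMeasurable, ?_⟩
  rw [hasFiniteIntegral_iff_ofReal (ae_of_all _ fun y => le_max_right _ (0 : ℝ)), h.lintegral_count hT]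
  exact ENNReal.sum_lt_top.2 fun _ _ => ENNReal.ofReal_lt_top

theorem integral_count (hT : 0 < T) (h : IsEnumeration T ξ) (z : ℝ) (k : ℕ) :
    ∫ y in Ico (0 : ℝ) T, max ((lastIndex T ξ (y + z) - lastIndex T ξ y : ℤ) - k : ℝ) 0
      = ∑ i ∈ Finset.range T, max (z - (ξ (i + k) - ξ i)) 0 := by
  rw [integral_eq_lintegral_of_nonneg_ae (ae_of_all _ fun y => le_max_right _ (0 : ℝ))
    (h.integrableOn_count hT z k).1, h.lintegral_count hT,
    ENNReal.toReal_sum fun _ _ => ENNReal.ofReal_ne_top]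
  rfl

end IsEnumeration

/-! ### Expansion of `|z - N| ^ p` in hinges, and bounds for the increment integral. -/

/-- The second difference `|t + 1|^p - 2 |t|^p + |t - 1|^p`. -/
def secondDiff (p t : ℝ) : ℝ := |t + 1| ^ p - 2 * |t| ^ p + |t - 1| ^ p

/-- The sum of `(z - (ξ (i + k) - ξ i))⁺` over one period. -/
def gapSum (T : ℕ) (ξ : ℤ → ℝ) (z : ℝ) (k : ℕ) : ℝ :=
  ∑ i ∈ Finset.range T, max (z - (ξ (i + k) - ξ i)) 0

/-- The integral of `|u (y + z) - u y|^p` over one period, in terms of the gaps of `ξ`;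
see `IsEnumeration.integral_rpow_count`. -/
def incrementIntegral (T : ℕ) (p : ℝ) (ξ : ℤ → ℝ) (z : ℝ) : ℝ :=
  T * |z| ^ p + (|z - 1| ^ p - |z| ^ p) * (T * z)
    + ∑ k ∈ Finset.range (⌈z⌉₊ + T), secondDiff p (z - (k + 1)) * gapSum T ξ z (k + 1)

/-- To the right of `K` the first `K` hinges have all opened, and the piecewise linear interpolant
continues along the line through the values at `K` and `K + 1`. -/
theorem sum_secondDiff_mul_max (f : ℕ → ℝ) (K : ℕ) {x : ℝ} (hx : K ≤ x) :
    f 0 + (f 1 - f 0) * x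
      + ∑ k ∈ Finset.range K, (f (k + 2) - 2 * f (k + 1) + f k) * max (x - (k + 1 : ℕ)) 0
      = f K + (f (K + 1) - f K) * (x - K) := by
  induction K with
  | zero => simp
  | succ K ih =>
    have hK : (K : ℝ) ≤ x := by push_cast at hx; linarith
    rw [Finset.sum_range_succ, ← add_assoc, ih hK, max_eq_left (by linarith)]
    push_cast
    ring

theorem eq_sum_secondDiff_mul_max (f : ℕ → ℝ) {K n : ℕ} (hn : n ≤ K) :
    f n = f 0 + (f 1 - f 0) * n
      + ∑ k ∈ Finset.range K, (f (k + 2) - 2 * f (k + 1) + f k) * max ((n : ℝ) - (k + 1 : ℕ)) 0 := by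
  rw [← Finset.sum_subset (Finset.range_mono hn), sum_secondDiff_mul_max f n le_rfl]
  · ring
  · intro k _ hk
    rw [Finset.mem_range, not_lt] at hk
    have : (n : ℝ) ≤ k := by exact_mod_cast hk
    rw [max_eq_right (by push_cast; linarith), mul_zero]

theorem secondDiff_eq (p z : ℝ) (k : ℕ) :
    |z - (k + 2 : ℕ)| ^ p - 2 * |z - (k + 1 : ℕ)| ^ p + |z - k| ^ p
      = secondDiff p (z - (k + 1)) := by
  unfold secondDiff
  push_cast
  rw [show z - (k + 1 : ℝ) + 1 = z - k by ring, show z - (k + 1 : ℝ) - 1 = z - (k + 2) by ring]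
  ring

/-- Midpoint convexity of `r ↦ r ^ p` at `|t + 1|` and `|t - 1|`. Their mean is at least `|t|`, and
equals `1` when `|t| < 1`; this keeps the second difference positive there even for `p = 1`. -/
theorem rpow_average_le_secondDiff {p : ℝ} (hp : 1 ≤ p) (t : ℝ) :
    2 * (((|t + 1| + |t - 1|) / 2) ^ p - |t| ^ p) ≤ secondDiff p t := by
  have := (convexOn_rpow hp).2 (abs_nonneg (t + 1)) (abs_nonneg (t - 1))
    (show (0 : ℝ) ≤ 1 / 2 by norm_num) (show (0 : ℝ) ≤ 1 / 2 by norm_num) (by norm_num)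
  simp only [smul_eq_mul] at this
  unfold secondDiff
  rw [show (|t + 1| + |t - 1|) / 2 = 1 / 2 * |t + 1| + 1 / 2 * |t - 1| by ring]
  linarith

theorem secondDiff_nonneg {p : ℝ} (hp : 1 ≤ p) (t : ℝ) : 0 ≤ secondDiff p t := by
  refine le_trans ?_ (rpow_average_le_secondDiff hp t)
  have h : |t| ≤ (|t + 1| + |t - 1|) / 2 := by
    have := abs_add_le (t + 1) (t - 1)
    rw [show t + 1 + (t - 1) = 2 * t by ring, abs_mul, abs_two] at this
    linarith
  have := Real.rpow_le_rpow (abs_nonneg t) h (show 0 ≤ p by linarith)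
  linarith

theorem secondDiff_pos {p t : ℝ} (hp : 1 ≤ p) (ht : |t| < 1) : 0 < secondDiff p t := by
  refine lt_of_lt_of_le ?_ (rpow_average_le_secondDiff hp t)
  have ht' := abs_lt.1 ht
  rw [abs_of_pos (by linarith), abs_of_neg (show t - 1 < 0 by linarith),
    show (t + 1 + -(t - 1)) / 2 = 1 by ring, Real.one_rpow]
  have := Real.rpow_lt_one (abs_nonneg t) ht (show 0 < p by linarith)
  linarith

theorem secondDiff_le {p t : ℝ} (hp : 1 ≤ p) (ht : |t| ≤ 1) : secondDiff p t ≤ 2 * 2 ^ p := by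
  have ht' := abs_le.1 ht
  have h1 := Real.rpow_le_rpow (abs_nonneg (t + 1))
    (show |t + 1| ≤ 2 by rw [abs_le]; constructor <;> linarith) (show 0 ≤ p by linarith)
  have h2 := Real.rpow_le_rpow (abs_nonneg (t - 1))
    (show |t - 1| ≤ 2 by rw [abs_le]; constructor <;> linarith) (show 0 ≤ p by linarith)
  have h3 := Real.rpow_nonneg (abs_nonneg t) p
  unfold secondDiff
  linarith

theorem Function.Periodic.setLIntegral_Ico_comp_add {T : ℝ} (hT : 0 < T) {f : ℝ → ℝ≥0∞}
    (hf : Function.Periodic f T) (z : ℝ) :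
    ∫⁻ y in Ico 0 T, f (y + z) = ∫⁻ y in Ico 0 T, f y := by
  have h1 : ∫⁻ y in Ico 0 T, f (y + z) = ∫⁻ y in Ico z (z + T), f y := by
    rw [← lintegral_indicator measurableSet_Ico, ← lintegral_indicator measurableSet_Ico,
      ← lintegral_add_right_eq_self ((Ico z (z + T)).indicator f) z]
    congr 1
    ext y
    by_cases hy : y ∈ Ico 0 T
    · rw [indicator_of_mem hy, indicator_of_mem]
      exact ⟨by linarith [hy.1], by linarith [hy.2]⟩
    · rw [indicator_of_notMem hy, indicator_of_notMem]
      exact fun h => hy ⟨by linarith [h.1], by linarith [h.2]⟩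
  rw [h1, setLIntegral_congr Ico_ae_eq_Ioc, setLIntegral_congr (Ico_ae_eq_Ioc (a := (0 : ℝ)))]
  have := (isAddFundamentalDomain_Ioc hT z).setLIntegral_eq (isAddFundamentalDomain_Ioc hT 0) f
    hf.map_vadd_zmultiples
  rwa [zero_add] at this

namespace IsEnumeration

variable {T : ℕ} {ξ : ℤ → ℝ}

theorem rpow_count_eq (hT : 0 < T) (h : IsEnumeration T ξ) (p y : ℝ) {z : ℝ} (hz : 0 ≤ z) :
    |z - ((lastIndex T ξ (y + z) - lastIndex T ξ y : ℤ) : ℝ)| ^ p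
      = |z| ^ p + (|z - 1| ^ p - |z| ^ p)
          * max ((lastIndex T ξ (y + z) - lastIndex T ξ y : ℤ) - (0 : ℕ) : ℝ) 0
        + ∑ k ∈ Finset.range (⌈z⌉₊ + T), secondDiff p (z - (k + 1))
          * max ((lastIndex T ξ (y + z) - lastIndex T ξ y : ℤ) - (k + 1 : ℕ) : ℝ) 0 := by
  have hb := abs_count_sub_le hT ξ y z
  obtain ⟨n, hn⟩ := Int.eq_ofNat_of_zero_le
    (sub_nonneg.2 (h.monotone_lastIndex hT (show y ≤ y + z by linarith)))
  rw [hn] at hb ⊢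
  -- From `|z - N| ≤ T`: this truncation of the hinge sum works for every `y` and every `ξ`, so
  -- increment integrals of different configurations can be compared term by term.
  have hnK : n ≤ ⌈z⌉₊ + T := by
    have h1 := (abs_le.1 hb).1
    have h2 := Nat.le_ceil z
    have : (n : ℝ) ≤ (⌈z⌉₊ + T : ℕ) := by push_cast at h1 ⊢; linarith
    exact_mod_cast this
  have := eq_sum_secondDiff_mul_max (fun m : ℕ => |z - m| ^ p) hnK
  simp only [secondDiff_eq] at this
  simpa using this

theorem integral_rpow_count (hT : 0 < T) (h : IsEnumeration T ξ) (p : ℝ) {z : ℝ} (hz : 0 ≤ z) :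
    IntegrableOn (fun y => |z - ((lastIndex T ξ (y + z) - lastIndex T ξ y : ℤ) : ℝ)| ^ p)
      (Ico (0 : ℝ) T) ∧
    ∫ y in Ico (0 : ℝ) T, |z - ((lastIndex T ξ (y + z) - lastIndex T ξ y : ℤ) : ℝ)| ^ p
      = incrementIntegral T p ξ z := by
  simp only [h.rpow_count_eq hT p _ hz]
  have i0 : IntegrableOn (fun _ : ℝ => |z| ^ p) (Ico (0 : ℝ) T) := integrableOn_const (by simp)
  have i1 := (h.integrableOn_count hT z 0).const_mul (|z - 1| ^ p - |z| ^ p)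
  have i2 := fun k : ℕ =>
    (h.integrableOn_count hT z (k + 1)).const_mul (secondDiff p (z - (k + 1)))
  have i3 := integrable_finsetSum (Finset.range (⌈z⌉₊ + T)) (fun k _ => i2 k)
  refine ⟨(i0.add i1).add i3, ?_⟩
  rw [integral_add (by exact i0.add i1) i3, integral_add i0 i1, integral_finsetSum _ fun k _ => i2 k]
  simp only [integral_const_mul, h.integral_count hT]
  -- The hinge at `0` is `N` itself; its integral, and hence the affine part, does not depend on the
  -- configuration.
  have hz0 : ∑ i ∈ Finset.range T, max (z - (ξ (i + (0 : ℕ)) - ξ i)) 0 = T * z := by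
    simp [max_eq_left hz]
  rw [hz0]
  unfold incrementIntegral gapSum
  simp

theorem incrementIntegral_nonneg (hT : 0 < T) (h : IsEnumeration T ξ) (p : ℝ) {z : ℝ}
    (hz : 0 ≤ z) : 0 ≤ incrementIntegral T p ξ z := by
  rw [← (h.integral_rpow_count hT p hz).2]
  exact integral_nonneg fun y => by positivity

theorem incrementIntegral_le (hT : 0 < T) (h : IsEnumeration T ξ) {p : ℝ} (hp : 1 ≤ p) {z : ℝ}
    (hz : 0 ≤ z) : incrementIntegral T p ξ z ≤ T ^ p * T := by
  rw [← (h.integral_rpow_count hT p hz).2]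
  calc _ ≤ ∫ y in Ico (0 : ℝ) T, (T : ℝ) ^ p :=
        setIntegral_mono (h.integral_rpow_count hT p hz).1 (integrableOn_const (by simp)) fun y =>
          Real.rpow_le_rpow (abs_nonneg _) (abs_count_sub_le hT ξ y z) (by linarith)
    _ = _ := by simp [mul_comm]

/-- With `w = |z - N| ≤ T` one has `w ^ p ≤ T ^ (p - 1) * (z + N)`, and `N` integrates to `T * z`.
The linear decay as `z → 0` gives integrability at zero when `s * p < 1`. -/
theorem incrementIntegral_le_mul (hT : 0 < T) (h : IsEnumeration T ξ) {p : ℝ} (hp : 1 ≤ p)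
    {z : ℝ} (hz : 0 ≤ z) : incrementIntegral T p ξ z ≤ 2 * T ^ p * z := by
  have hT' : (0 : ℝ) < T := by exact_mod_cast hT
  rw [← (h.integral_rpow_count hT p hz).2]
  have i0 : IntegrableOn (fun _ : ℝ => z) (Ico (0 : ℝ) T) := integrableOn_const (by simp)
  have i1 := h.integrableOn_count hT z 0
  have e := h.integral_count hT z 0
  have hz0 : ∑ i ∈ Finset.range T, max (z - (ξ (i + (0 : ℕ)) - ξ i)) 0 = T * z := by
    simp [max_eq_left hz]
  rw [hz0] at e
  calc _ ≤ ∫ y in Ico (0 : ℝ) T, (T : ℝ) ^ (p - 1)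
          * (z + max ((lastIndex T ξ (y + z) - lastIndex T ξ y : ℤ) - (0 : ℕ) : ℝ) 0) := by
        refine setIntegral_mono (h.integral_rpow_count hT p hz).1 ((i0.add i1).const_mul _)
          fun y => ?_
        set w := |z - ((lastIndex T ξ (y + z) - lastIndex T ξ y : ℤ) : ℝ)| with hw
        have hw0 : 0 ≤ w := abs_nonneg _
        have hwT : w ≤ T := abs_count_sub_le hT ξ y z
        have hwz : w ≤ z + max ((lastIndex T ξ (y + z) - lastIndex T ξ y : ℤ) - (0 : ℕ) : ℝ) 0 := by
          have : (0 : ℝ) ≤ (lastIndex T ξ (y + z) - lastIndex T ξ y : ℤ) := by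
            exact_mod_cast sub_nonneg.2 (h.monotone_lastIndex hT (show y ≤ y + z by linarith))
          rw [Nat.cast_zero, sub_zero, max_eq_left this, hw, abs_le]
          constructor <;> linarith
        change w ^ p ≤ _
        calc w ^ p = w ^ (p - 1) * w := by
              rcases hw0.eq_or_lt with h0 | h0
              · rw [← h0, Real.zero_rpow (by linarith), mul_zero]
              · rw [← Real.rpow_add_one h0.ne', sub_add_cancel]
          _ ≤ _ := mul_le_mul (Real.rpow_le_rpow hw0 hwT (by linarith)) hwz hw0 (by positivity)
    _ = _ := by
        rw [integral_const_mul, integral_add i0 i1, e]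
        simp only [integral_const, smul_eq_mul, measureReal_restrict_apply_univ,
          Real.volume_real_Ico_of_le hT'.le]
        rw [show (2 : ℝ) * T ^ p = 2 * (T ^ (p - 1) * T) by
          rw [← Real.rpow_add_one hT'.ne', sub_add_cancel]]
        ring

end IsEnumeration

/-! ### Slicing the energy by increments; finiteness. -/

theorem measurable_jumpProfile (T : ℕ) (x : Fin T → ℝ) : Measurable (jumpProfile T x) := by
  unfold jumpProfile
  refine measurable_id.sub (Finset.measurable_fun_sum _ fun i _ => ?_)
  exact measurable_from_top.comp
    (Int.measurable_floor.comp ((measurable_id.sub_const (x i)).div_const (T : ℝ)))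

/-- The integral of `|u y - u (y + z)|^p / |z|^(1 + s p)` over one period. -/
def incrementEnergy (T : ℕ) (s p : ℝ) (x : Fin T → ℝ) (z : ℝ) : ℝ≥0∞ :=
  ∫⁻ y in Ico (0 : ℝ) T,
    ENNReal.ofReal (|jumpProfile T x y - jumpProfile T x (y + z)| ^ p / |z| ^ (1 + s * p))

theorem measurable_increment (T : ℕ) (s p : ℝ) (x : Fin T → ℝ) :
    Measurable fun q : ℝ × ℝ => ENNReal.ofReal
      (|jumpProfile T x q.1 - jumpProfile T x (q.1 + q.2)| ^ p / |q.2| ^ (1 + s * p)) := by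
  have := measurable_jumpProfile T x
  fun_prop

theorem measurable_incrementEnergy (T : ℕ) (s p : ℝ) (x : Fin T → ℝ) :
    Measurable (incrementEnergy T s p x) :=
  (measurable_increment T s p x).lintegral_prod_left'

theorem jumpEnergy_eq_lintegral_incrementEnergy (T : ℕ) (s p : ℝ) (x : Fin T → ℝ) :
    jumpEnergy T s p x = ∫⁻ z, incrementEnergy T s p x z := by
  unfold jumpEnergy gagliardoEnergy incrementEnergy
  rw [lintegral_lintegral_swap (f := fun z y => ENNReal.ofReal
      (|jumpProfile T x y - jumpProfile T x (y + z)| ^ p / |z| ^ (1 + s * p)))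
      ((measurable_increment T s p x).comp measurable_swap).aemeasurable,
    setLIntegral_congr Ico_ae_eq_Icc.symm]
  refine lintegral_congr fun y => ?_
  rw [← lintegral_add_left_eq_self _ y]
  refine lintegral_congr fun z => ?_
  rw [sub_add_cancel_left, abs_neg]

/-- By periodicity `y` may be shifted by `-z`, which exchanges the two endpoints of the increment.
-/
theorem incrementEnergy_neg {T : ℕ} (hT : 0 < T) (s p : ℝ) (x : Fin T → ℝ) (z : ℝ) :
    incrementEnergy T s p x (-z) = incrementEnergy T s p x z := by
  have hu := jumpProfile_periodic hT x
  unfold incrementEnergy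
  rw [← Function.Periodic.setLIntegral_Ico_comp_add (f := fun y => ENNReal.ofReal
    (|jumpProfile T x y - jumpProfile T x (y + z)| ^ p / |z| ^ (1 + s * p)))
    (by exact_mod_cast hT) ?_ (-z)]
  · refine lintegral_congr fun y => ?_
    rw [abs_neg, neg_add_cancel_right, abs_sub_comm]
  · intro y
    simp only [hu y, show y + T + z = y + z + T by ring, hu (y + z)]

theorem jumpEnergy_eq_two_mul {T : ℕ} (hT : 0 < T) (s p : ℝ) (x : Fin T → ℝ) :
    jumpEnergy T s p x = 2 * ∫⁻ z in Ioi 0, incrementEnergy T s p x z := by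
  rw [jumpEnergy_eq_lintegral_incrementEnergy, ← lintegral_add_compl _ measurableSet_Ioi, compl_Ioi,
    setLIntegral_congr Iio_ae_eq_Iic.symm, two_mul]
  congr 1
  rw [← (Measure.measurePreserving_neg (volume : Measure ℝ)).setLIntegral_comp_preimage_emb
    (Homeomorph.neg ℝ).measurableEmbedding]
  simp only [incrementEnergy_neg hT]
  simp

namespace IsEnumeration

variable {T : ℕ} {ξ : ℤ → ℝ}

theorem incrementEnergy_eq (hT : 0 < T) (h : IsEnumeration T ξ) {x : Fin T → ℝ}
    (hx : Enumerates T ξ x) (s p : ℝ) {z : ℝ} (hz : 0 < z) :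
    incrementEnergy T s p x z
      = ENNReal.ofReal (incrementIntegral T p ξ z / z ^ (1 + s * p)) := by
  unfold incrementEnergy
  obtain ⟨hi, he⟩ := h.integral_rpow_count hT p hz.le
  rw [← he, ← integral_div, ofReal_integral_eq_lintegral_ofReal (hi.div_const _)
    (ae_of_all _ fun y => by positivity)]
  simp only [hx.sub_jumpProfile hT, abs_of_pos hz, abs_sub_comm z]

theorem jumpEnergy_eq (hT : 0 < T) (h : IsEnumeration T ξ) {x : Fin T → ℝ}
    (hx : Enumerates T ξ x) (s p : ℝ) :
    jumpEnergy T s p x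
      = 2 * ∫⁻ z in Ioi 0, ENNReal.ofReal (incrementIntegral T p ξ z / z ^ (1 + s * p)) := by
  rw [jumpEnergy_eq_two_mul hT]
  congr 1
  exact setLIntegral_congr_fun measurableSet_Ioi fun z hz => h.incrementEnergy_eq hT hx s p hz

theorem integrableOn_incrementIntegral (hT : 0 < T) (h : IsEnumeration T ξ) {s p : ℝ}
    (hp : 1 ≤ p) (hs0 : 0 < s) (hsp : s * p < 1) :
    IntegrableOn (fun z => incrementIntegral T p ξ z / z ^ (1 + s * p)) (Ioi 0) := by
  have hsp0 : 0 < s * p := by positivity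
  obtain ⟨x, hx⟩ : ∃ x : Fin T → ℝ, Enumerates T ξ x := ⟨fun i => ξ (i : ℕ), 1, 0, by simp⟩
  have hm : AEStronglyMeasurable (fun z => incrementIntegral T p ξ z / z ^ (1 + s * p))
      (volume.restrict (Ioi 0)) := by
    -- Measurability in `z` is inherited from `incrementEnergy`, whose real value this function is
    -- for `z > 0`.
    refine (measurable_incrementEnergy T s p x).ennreal_toReal.aestronglyMeasurable.congr ?_
    filter_upwards [ae_restrict_mem measurableSet_Ioi] with z hz
    have hz' : 0 < z := hz
    rw [h.incrementEnergy_eq hT hx s p hz, ENNReal.toReal_ofReal]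
    exact div_nonneg (h.incrementIntegral_nonneg hT p hz'.le) (by positivity)
  -- Near zero the linear bound leaves `z ^ (-(s * p))`, integrable since `s * p < 1`; at infinity
  -- the uniform bound leaves `z ^ (-(1 + s * p))`, integrable since `s * p > 0`.
  rw [← Ioc_union_Ioi_eq_Ioi (zero_le_one (α := ℝ))]
  refine IntegrableOn.union ?_ ?_
  · have i1 : IntegrableOn (fun z : ℝ => 2 * (T : ℝ) ^ p * z ^ (-(s * p))) (Ioc 0 1) :=
      ((intervalIntegrable_iff_integrableOn_Ioc_of_le zero_le_one).1
        (intervalIntegral.intervalIntegrable_rpow' (by linarith))).const_mul _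
    refine i1.mono' (hm.mono_set Ioc_subset_Ioi_self) ?_
    filter_upwards [ae_restrict_mem measurableSet_Ioc] with z hz
    have hz' : 0 < z := hz.1
    have h0 := h.incrementIntegral_nonneg hT p hz'.le
    rw [Real.norm_of_nonneg (by positivity), div_le_iff₀ (by positivity), mul_assoc,
      ← Real.rpow_add hz', show -(s * p) + (1 + s * p) = 1 by ring, Real.rpow_one]
    exact h.incrementIntegral_le_mul hT hp hz'.le
  · have i1 : IntegrableOn (fun z : ℝ => (T : ℝ) ^ p * T * z ^ (-(1 + s * p))) (Ioi 1) :=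
      (integrableOn_Ioi_rpow_of_lt (by linarith) one_pos).const_mul _
    refine i1.mono' (hm.mono_set (Ioi_subset_Ioi zero_le_one)) ?_
    filter_upwards [ae_restrict_mem measurableSet_Ioi] with z hz
    have hz' : 0 < z := one_pos.trans hz
    have h0 := h.incrementIntegral_nonneg hT p hz'.le
    rw [Real.norm_of_nonneg (by positivity), div_le_iff₀ (by positivity), mul_assoc,
      ← Real.rpow_add hz', neg_add_cancel, Real.rpow_zero, mul_one]
    exact h.incrementIntegral_le hT hp hz'.le

theorem jumpEnergy_eq_ofReal (hT : 0 < T) (h : IsEnumeration T ξ) {s p : ℝ}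
    (hp : 1 ≤ p) (hs0 : 0 < s) (hsp : s * p < 1) {x : Fin T → ℝ} (hx : Enumerates T ξ x) :
    jumpEnergy T s p x
      = ENNReal.ofReal (2 * ∫ z in Ioi 0, incrementIntegral T p ξ z / z ^ (1 + s * p)) := by
  rw [h.jumpEnergy_eq hT hx, ENNReal.ofReal_mul zero_le_two, ENNReal.ofReal_ofNat,
    ofReal_integral_eq_lintegral_ofReal (h.integrableOn_incrementIntegral hT hp hs0 hsp)]
  filter_upwards [ae_restrict_mem measurableSet_Ioi] with z hz
  have hz' : 0 < z := hz
  exact div_nonneg (h.incrementIntegral_nonneg hT p hz'.le) (by positivity)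

theorem toReal_jumpEnergy (hT : 0 < T) (h : IsEnumeration T ξ) {s p : ℝ}
    (hp : 1 ≤ p) (hs0 : 0 < s) (hsp : s * p < 1) {x : Fin T → ℝ} (hx : Enumerates T ξ x) :
    (jumpEnergy T s p x).toReal
      = 2 * ∫ z in Ioi 0, incrementIntegral T p ξ z / z ^ (1 + s * p) := by
  rw [h.jumpEnergy_eq_ofReal hT hp hs0 hsp hx, ENNReal.toReal_ofReal]
  refine mul_nonneg zero_le_two (setIntegral_nonneg measurableSet_Ioi fun z hz => ?_)
  have hz' : 0 < z := hz
  exact div_nonneg (h.incrementIntegral_nonneg hT p hz'.le) (by positivity)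

end IsEnumeration

/-! ### Ordered tuples and their enumerations. -/

/-- The extension of a tuple to all integer indices by `ξ (n + T) = ξ n + T`. -/
def periodicExtension {T : ℕ} [NeZero T] (x : Fin T → ℝ) (n : ℤ) : ℝ :=
  x (Int.divModEquiv T n).2 + (Int.divModEquiv T n).1 * T

/-- The tuples whose periodic extension is nondecreasing. -/
def orderedTuples (T : ℕ) : Set (Fin T → ℝ) := {x | Monotone x ∧ ∀ i j, x i ≤ x j + T}

section periodicExtension

variable {T : ℕ} [NeZero T]

theorem periodicExtension_add_mul (x : Fin T → ℝ) (i : Fin T) (m : ℤ) :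
    periodicExtension x ((i : ℕ) + m * T) = x i + m * T := by
  have : ((i : ℕ) : ℤ) + m * T = (Int.divModEquiv T).symm (m, i) := by
    simp [Int.divModEquiv, add_comm]
  unfold periodicExtension
  rw [this, Equiv.apply_symm_apply]

theorem periodicExtension_coe (x : Fin T → ℝ) (i : Fin T) :
    periodicExtension x (i : ℕ) = x i := by
  simpa using periodicExtension_add_mul x i 0

theorem exists_eq_add_mul (T : ℕ) [NeZero T] (n : ℤ) :
    ∃ (i : Fin T) (m : ℤ), n = (i : ℕ) + m * T := by
  refine ⟨(Int.divModEquiv T n).2, (Int.divModEquiv T n).1, ?_⟩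
  conv_lhs => rw [← (Int.divModEquiv T).symm_apply_apply n]
  simp [Int.divModEquiv, add_comm, -Equiv.symm_apply_apply]

theorem enumerates_periodicExtension (x : Fin T → ℝ) : Enumerates T (periodicExtension x) x :=
  ⟨1, 0, fun i => by simp [periodicExtension_coe]⟩

theorem isEnumeration_periodicExtension {x : Fin T → ℝ} (hx : x ∈ orderedTuples T) :
    IsEnumeration T (periodicExtension x) := by
  refine ⟨fun a b hab => ?_, fun n => ?_⟩
  · obtain ⟨i, m, rfl⟩ := exists_eq_add_mul T a
    obtain ⟨j, l, rfl⟩ := exists_eq_add_mul T b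
    rw [periodicExtension_add_mul, periodicExtension_add_mul]
    have hi := i.isLt
    have hj := j.isLt
    have hml : m ≤ l := by
      by_contra! hlm
      have : ((l + 1 : ℤ)) * T ≤ m * T := by gcongr; omega
      linarith [show ((j : ℕ) : ℤ) < T by omega]
    rcases hml.eq_or_lt with rfl | hlt
    · have : i ≤ j := by
        rw [Fin.le_def]
        omega
      linarith [hx.1 this]
    · have h1 : ((m : ℝ) + 1) * T ≤ l * T := by
        gcongr
        exact_mod_cast hlt
      linarith [hx.2 i j]
  · obtain ⟨i, m, rfl⟩ := exists_eq_add_mul T n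
    rw [show ((i : ℕ) : ℤ) + m * T + T = (i : ℕ) + (m + 1) * T by ring, periodicExtension_add_mul,
      periodicExtension_add_mul]
    push_cast
    ring

theorem convex_orderedTuples (T : ℕ) : Convex ℝ (orderedTuples T) := by
  intro x hx y hy a b ha hb hab
  refine ⟨fun i j hij => ?_, fun i j => ?_⟩
  · simp only [Pi.add_apply, Pi.smul_apply, smul_eq_mul]
    gcongr
    · exact hx.1 hij
    · exact hy.1 hij
  · simp only [Pi.add_apply, Pi.smul_apply, smul_eq_mul]
    have h1 := mul_le_mul_of_nonneg_left (hx.2 i j) ha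
    have h2 := mul_le_mul_of_nonneg_left (hy.2 i j) hb
    have h3 : (T : ℝ) = a * T + b * T := by rw [← add_mul, hab, one_mul]
    linarith

/-- The extension is affine rather than linear in the tuple, because of the fixed shifts `m T`;
hence the condition on the weights. -/
theorem periodicExtension_combo (x y : Fin T → ℝ) {a b : ℝ} (hab : a + b = 1) (n : ℤ) :
    periodicExtension (a • x + b • y) n
      = a * periodicExtension x n + b * periodicExtension y n := by
  simp only [periodicExtension, Pi.add_apply, Pi.smul_apply, smul_eq_mul]
  linear_combination -(((Int.divModEquiv T n).1 : ℝ) * T) * hab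

/-- Every configuration has a nondecreasing enumeration. -/
theorem exists_isEnumeration (x : Fin T → ℝ) :
    ∃ ξ : ℤ → ℝ, IsEnumeration T ξ ∧ Enumerates T ξ x := by
  have hT' : (0 : ℝ) < T := by exact_mod_cast Nat.pos_of_neZero T
  set w : Fin T → ℝ := fun i => toIcoMod hT' 0 (x i)
  have hw : ∀ i, w i ∈ Ico (0 : ℝ) T := fun i => by
    simpa using toIcoMod_mem_Ico hT' 0 (x i)
  have hord : w ∘ Tuple.sort w ∈ orderedTuples T :=
    ⟨Tuple.monotone_sort w, fun i j => by
      have h1 := (hw (Tuple.sort w i)).2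
      have h2 := (hw (Tuple.sort w j)).1
      simp only [Function.comp]
      linarith⟩
  refine ⟨_, isEnumeration_periodicExtension hord, Tuple.sort w,
    fun i => toIcoDiv hT' 0 (x (Tuple.sort w i)), fun i => ?_⟩
  rw [periodicExtension_coe]
  have := toIcoMod_add_toIcoDiv_zsmul hT' 0 (x (Tuple.sort w i))
  rw [zsmul_eq_mul] at this
  exact this.symm

end periodicExtension

theorem jumpEnergy_ne_top {T : ℕ} (hT : 0 < T) {s p : ℝ} (hp : 1 ≤ p) (hs0 : 0 < s)
    (hsp : s * p < 1) (x : Fin T → ℝ) : jumpEnergy T s p x ≠ ⊤ := by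
  have : NeZero T := ⟨hT.ne'⟩
  obtain ⟨ξ, h, hx⟩ := exists_isEnumeration x
  rw [h.jumpEnergy_eq_ofReal hT hp hs0 hsp hx]
  exact ENNReal.ofReal_ne_top

/-! ### A minimality criterion from partial derivatives. -/

/-- A convex function whose partial derivatives exist and vanish at a point that can be moved inside
the domain along every coordinate is minimal there. -/
theorem ConvexOn.le_of_partialDeriv_eq_zero {ι : Type*} [Fintype ι] [DecidableEq ι] [Nonempty ι]
    {C : Set (ι → ℝ)} {f : (ι → ℝ) → ℝ} (hf : ConvexOn ℝ C f) {x y : ι → ℝ} (hy : y ∈ C)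
    {δ : ℝ} (hδ : 0 < δ) (hmem : ∀ i h, |h| < δ → Function.update x i (x i + h) ∈ C)
    (hd : ∀ i, HasDerivAt (fun h : ℝ => f (Function.update x i (x i + h))) 0 0) :
    f x ≤ f y := by
  set N : ℝ := (Fintype.card ι : ℝ) with hN
  have hN0 : 0 < N := by
    rw [hN]
    exact_mod_cast Fintype.card_pos
  -- Each coordinate is moved away from `y`, with a factor `N` so that the average of the `N`
  -- displaced points is `x - t • (y - x)`. Convexity then bounds `f` there by `f x + o(t)` from the
  -- partial derivatives alone.
  set a : ι → ℝ → ℝ := fun i t => -(N * (y i - x i)) * t with ha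
  have hφ : ∀ i, HasDerivAt (fun t => f (Function.update x i (x i + a i t))) 0 0 := by
    intro i
    have h1 : HasDerivAt (a i) (-(N * (y i - x i))) 0 := by
      have := (hasDerivAt_id' (0 : ℝ)).const_mul (-(N * (y i - x i)))
      rwa [mul_one] at this
    have h2 : HasDerivAt (fun h : ℝ => f (Function.update x i (x i + h))) 0 (a i 0) := by
      simpa [ha] using hd i
    have := h2.comp (0 : ℝ) h1
    rw [zero_mul] at this
    exact this
  have hψ : HasDerivAt (fun t => ∑ i, (1 / N) * f (Function.update x i (x i + a i t))) 0 0 := by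
    simpa using HasDerivAt.fun_sum (u := Finset.univ) fun i _ => (hφ i).const_mul (1 / N)
  have hψ0 : ∑ i, (1 / N) * f (Function.update x i (x i + a i 0)) = f x := by
    simp [ha, ← hN, hN0.ne']
  have hsmall : ∀ᶠ t in 𝓝[>] (0 : ℝ), ∀ i, |a i t| < δ := by
    refine eventually_all.2 fun i => ?_
    have hc : Tendsto (fun t => |a i t|) (𝓝 0) (𝓝 0) := by
      have : Continuous fun t => |a i t| := by
        simp only [ha]
        fun_prop
      simpa [ha] using this.tendsto 0
    exact (hc.mono_left nhdsWithin_le_nhds).eventually (gt_mem_nhds hδ)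
  have hlim := hψ.tendsto_slope_zero_right
  have hle : f x - f y ≤ 0 := by
    refine ge_of_tendsto hlim ?_
    filter_upwards [hsmall, self_mem_nhdsWithin] with t ht ht0
    have ht0' : 0 < t := ht0
    have hsum1 : ∑ _i : ι, 1 / N = 1 := by simp [← hN, hN0.ne']
    have hcomb : ∑ i, (1 / N) • Function.update x i (x i + a i t) = x - t • (y - x) := by
      ext j
      have e : ∀ i, (1 / N) * Function.update x i (x i + a i t) j
          = (1 / N) * x j + if i = j then (1 / N) * a j t else 0 := by
        intro i
        by_cases hij : i = j
        · subst hij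
          simp [mul_add]
        · simp [Function.update_of_ne (Ne.symm hij), hij]
      simp only [Finset.sum_apply, Pi.smul_apply, smul_eq_mul, e, Finset.sum_add_distrib,
        ← Finset.sum_mul, hsum1, Finset.sum_ite_eq', Finset.mem_univ, if_true, Pi.sub_apply]
      simp only [ha]
      field_simp
      ring
    have hw : ∀ i ∈ Finset.univ, (0 : ℝ) ≤ (fun _ : ι => 1 / N) i := fun _ _ => by positivity
    have hmem' : ∀ i ∈ Finset.univ, Function.update x i (x i + a i t) ∈ C :=
      fun i _ => hmem i _ (ht i)
    have h1 := hf.map_sum_le hw hsum1 hmem'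
    have hxt : x - t • (y - x) ∈ C := by
      rw [← hcomb]
      exact hf.1.sum_mem hw hsum1 hmem'
    rw [hcomb] at h1
    -- Since `x` lies between `x - t • (y - x)` and `y`, convexity gives `(1 + t) * f x ≤ f (x - t •
    -- (y - x)) + t * f y`; dividing by `t` and letting `t → 0` yields the claim.
    have h2 := hf.2 hxt hy (show 0 ≤ 1 / (1 + t) by positivity) (show 0 ≤ t / (1 + t) by positivity)
      (by field_simp)
    have e2 : (1 / (1 + t)) • (x - t • (y - x)) + (t / (1 + t)) • y = x := by
      ext j
      simp only [Pi.add_apply, Pi.smul_apply, Pi.sub_apply, smul_eq_mul]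
      field_simp
      ring
    rw [e2, smul_eq_mul, smul_eq_mul] at h2
    have h3 : (1 + t) * f x ≤ f (x - t • (y - x)) + t * f y := by
      have := mul_le_mul_of_nonneg_left h2 (show 0 ≤ 1 + t by positivity)
      field_simp at this
      linarith
    simp only [smul_eq_mul] at h1
    rw [zero_add, hψ0, smul_eq_mul, le_inv_mul_iff₀ ht0']
    linarith
  linarith

/-! ### Convexity of the energy on ordered tuples. -/

theorem isEnumeration_intCast_add (T : ℕ) (a : ℝ) : IsEnumeration T (fun n : ℤ => (n : ℝ) + a) :=
  ⟨fun m n h => by simpa using h, fun n => by push_cast; ring⟩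

theorem gapSum_intCast_add (T : ℕ) (a z : ℝ) (k : ℕ) :
    gapSum T (fun n : ℤ => (n : ℝ) + a) z k = T * max (z - k) 0 := by
  simp [gapSum]

theorem incrementIntegral_intCast_add (T : ℕ) (p a z : ℝ) :
    incrementIntegral T p (fun n : ℤ => (n : ℝ) + a) z
      = incrementIntegral T p (fun n : ℤ => (n : ℝ) + 0) z := by
  simp only [incrementIntegral, gapSum_intCast_add]

theorem gapSum_combo_le (T : ℕ) (ξ η : ℤ → ℝ) {a b : ℝ} (ha : 0 ≤ a) (hb : 0 ≤ b) (hab : a + b = 1)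
    (z : ℝ) (k : ℕ) :
    gapSum T (fun n => a * ξ n + b * η n) z k ≤ a * gapSum T ξ z k + b * gapSum T η z k := by
  unfold gapSum
  rw [Finset.mul_sum, Finset.mul_sum, ← Finset.sum_add_distrib]
  refine Finset.sum_le_sum fun i _ => max_le ?_ (by positivity)
  have h1 := mul_le_mul_of_nonneg_left (le_max_left (z - (ξ (i + k) - ξ i)) 0) ha
  have h2 := mul_le_mul_of_nonneg_left (le_max_left (z - (η (i + k) - η i)) 0) hb
  have h3 : z = a * z + b * z := by rw [← add_mul, hab, one_mul]
  linarith

/-- Each hinge is convex in the gaps, the weights `secondDiff` are nonnegative, and the remaining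
terms do not involve the configuration. -/
theorem incrementIntegral_combo_le (T : ℕ) {p : ℝ} (hp : 1 ≤ p) (ξ η : ℤ → ℝ) {a b : ℝ}
    (ha : 0 ≤ a) (hb : 0 ≤ b) (hab : a + b = 1) (z : ℝ) :
    incrementIntegral T p (fun n => a * ξ n + b * η n) z
      ≤ a * incrementIntegral T p ξ z + b * incrementIntegral T p η z := by
  have h1 : ∑ k ∈ Finset.range (⌈z⌉₊ + T), secondDiff p (z - (k + 1))
        * gapSum T (fun n => a * ξ n + b * η n) z (k + 1)
      ≤ ∑ k ∈ Finset.range (⌈z⌉₊ + T), (a * (secondDiff p (z - (k + 1)) * gapSum T ξ z (k + 1))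
        + b * (secondDiff p (z - (k + 1)) * gapSum T η z (k + 1))) := by
    refine Finset.sum_le_sum fun k _ => ?_
    have := mul_le_mul_of_nonneg_left (gapSum_combo_le T ξ η ha hb hab z (k + 1))
      (secondDiff_nonneg hp (z - (k + 1)))
    linarith
  rw [Finset.sum_add_distrib, ← Finset.mul_sum, ← Finset.mul_sum] at h1
  unfold incrementIntegral
  generalize (T : ℝ) * |z| ^ p + (|z - 1| ^ p - |z| ^ p) * (T * z) = c
  have h3 : c = a * c + b * c := by rw [← add_mul, hab, one_mul]
  linarith

theorem convexOn_jumpEnergy {T : ℕ} (hT : 0 < T) {s p : ℝ} (hp : 1 ≤ p) (hs0 : 0 < s)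
    (hsp : s * p < 1) :
    ConvexOn ℝ (orderedTuples T) (fun x => (jumpEnergy T s p x).toReal) := by
  have : NeZero T := ⟨hT.ne'⟩
  refine ⟨convex_orderedTuples T, fun x hx y hy a b ha hb hab => ?_⟩
  have hx' := isEnumeration_periodicExtension hx
  have hy' := isEnumeration_periodicExtension hy
  have hxy' := isEnumeration_periodicExtension (convex_orderedTuples T hx hy ha hb hab)
  simp only
  rw [hx'.toReal_jumpEnergy hT hp hs0 hsp (enumerates_periodicExtension x),
    hy'.toReal_jumpEnergy hT hp hs0 hsp (enumerates_periodicExtension y),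
    hxy'.toReal_jumpEnergy hT hp hs0 hsp (enumerates_periodicExtension _)]
  have ix := (hx'.integrableOn_incrementIntegral hT hp hs0 hsp).const_mul a
  have iy := (hy'.integrableOn_incrementIntegral hT hp hs0 hsp).const_mul b
  have hle : ∫ z in Ioi 0, incrementIntegral T p (periodicExtension (a • x + b • y)) z
        / z ^ (1 + s * p)
      ≤ ∫ z in Ioi 0, (a * (incrementIntegral T p (periodicExtension x) z / z ^ (1 + s * p))
        + b * (incrementIntegral T p (periodicExtension y) z / z ^ (1 + s * p))) := by
    refine setIntegral_mono_on (hxy'.integrableOn_incrementIntegral hT hp hs0 hsp)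
      (ix.add iy) measurableSet_Ioi fun z hz => ?_
    have hz' : 0 < z := hz
    rw [← mul_div_assoc, ← mul_div_assoc, ← add_div]
    gcongr
    rw [funext fun n => periodicExtension_combo x y hab n]
    exact incrementIntegral_combo_le T hp _ _ ha hb hab z
  rw [integral_add ix iy, integral_const_mul, integral_const_mul] at hle
  simp only [smul_eq_mul]
  linarith

/-! ### Comparison with equispaced points: Jensen, equality case, perturbation. -/

namespace IsEnumeration

variable {T : ℕ} {ξ : ℤ → ℝ}

/-- Increasing `k` by one adds a telescoping sum over a full period, equal to `T`. -/
theorem sum_gap (h : IsEnumeration T ξ) (k : ℕ) :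
    ∑ i ∈ Finset.range T, (ξ (i + k) - ξ i) = T * k := by
  induction k with
  | zero => simp
  | succ k ih =>
    have e := Finset.sum_range_sub (fun i : ℕ => ξ ((i : ℤ) + k)) T
    have hp := h.add_period k
    rw [add_comm] at hp
    rw [hp] at e
    have : ∀ i : ℕ, ξ (i + (k + 1 : ℕ)) - ξ i
        = (ξ (((i + 1 : ℕ) : ℤ) + k) - ξ (i + k)) + (ξ (i + k) - ξ i) := by
      intro i
      rw [show (i : ℤ) + (k + 1 : ℕ) = ((i + 1 : ℕ) : ℤ) + k by push_cast; ring]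
      ring
    simp only [this, Finset.sum_add_distrib, ih, e]
    push_cast
    simp only [zero_add]
    ring

/-- Jensen's inequality for the hinge, the mean of the `k`-step gaps being `k`. -/
theorem le_gapSum (h : IsEnumeration T ξ) (z : ℝ) (k : ℕ) :
    T * max (z - k) 0 ≤ gapSum T ξ z k := by
  rw [mul_max_of_nonneg _ _ (Nat.cast_nonneg T), mul_zero]
  refine max_le ?_ (Finset.sum_nonneg fun _ _ => le_max_right _ _)
  calc (T : ℝ) * (z - k) = ∑ i ∈ Finset.range T, (z - (ξ (i + k) - ξ i)) := by
        rw [Finset.sum_sub_distrib, h.sum_gap]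
        simp [mul_sub]
    _ ≤ _ := Finset.sum_le_sum fun _ _ => le_max_left _ _

theorem incrementIntegral_equispaced_le (h : IsEnumeration T ξ) {p : ℝ} (hp : 1 ≤ p) (z : ℝ) :
    incrementIntegral T p (fun n : ℤ => (n : ℝ) + 0) z ≤ incrementIntegral T p ξ z := by
  unfold incrementIntegral
  gcongr with k
  · exact secondDiff_nonneg hp _
  · rw [gapSum_intCast_add]
    exact h.le_gapSum z (k + 1)

theorem incrementIntegral_equispaced_lt (h : IsEnumeration T ξ) {p : ℝ} (hp : 1 ≤ p) {z : ℝ}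
    (hz0 : 0 < z) (hz1 : z < 1) {i : ℕ} (hi : i < T) (hiz : ξ (i + 1) - ξ i < z) :
    incrementIntegral T p (fun n : ℤ => (n : ℝ) + 0) z < incrementIntegral T p ξ z := by
  unfold incrementIntegral
  gcongr 1
  -- Strictness comes from the one-step gaps (summation index `0`): for `z < 1` the equispaced sum
  -- vanishes, the other does not, and the weight is positive because `|z - 1| < 1`.
  refine Finset.sum_lt_sum (fun k _ => ?_) ⟨0, Finset.mem_range.2 (by omega), ?_⟩
  · rw [gapSum_intCast_add]
    exact mul_le_mul_of_nonneg_left (h.le_gapSum z (k + 1)) (secondDiff_nonneg hp _)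
  · rw [gapSum_intCast_add]
    refine mul_lt_mul_of_pos_left ?_ (secondDiff_pos hp ?_)
    · rw [max_eq_right (by push_cast; linarith), mul_zero]
      refine lt_of_lt_of_le ?_ (Finset.single_le_sum (fun _ _ => le_max_right _ _)
        (Finset.mem_range.2 hi))
      simp only [zero_add, Nat.cast_one]
      exact lt_max_of_lt_left (by linarith)
    · rw [abs_lt]
      constructor <;> push_cast <;> linarith

/-- A one-step gap below `1` would make the inequality strict on a `z`-interval of positive length.
So all these gaps are at least `1`, and their sum over a period is `T`. -/
theorem gap_eq_one_of_integral_le (hT : 0 < T) (h : IsEnumeration T ξ) {s p : ℝ} (hp : 1 ≤ p)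
    (hs0 : 0 < s) (hsp : s * p < 1)
    (hle : ∫ z in Ioi 0, incrementIntegral T p ξ z / z ^ (1 + s * p)
      ≤ ∫ z in Ioi 0, incrementIntegral T p (fun n : ℤ => (n : ℝ) + 0) z / z ^ (1 + s * p)) :
    ∀ i < T, ξ ((i : ℤ) + 1) - ξ i = 1 := by
  have i1 := h.integrableOn_incrementIntegral hT hp hs0 hsp
  have i0 := (isEnumeration_intCast_add T 0).integrableOn_incrementIntegral hT hp hs0 hsp
  have hge : ∀ i ∈ Finset.range T, 1 ≤ ξ ((i : ℤ) + 1) - ξ i := by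
    intro i hi
    by_contra! hlt
    have hd0 : 0 ≤ ξ ((i : ℤ) + 1) - ξ i := sub_nonneg.2 (h.mono (by omega))
    have hnn : 0 ≤ᵐ[volume.restrict (Ioi 0)] fun z => incrementIntegral T p ξ z / z ^ (1 + s * p)
        - incrementIntegral T p (fun n : ℤ => (n : ℝ) + 0) z / z ^ (1 + s * p) := by
      filter_upwards [ae_restrict_mem measurableSet_Ioi] with z hz
      have hz' : 0 < z := hz
      refine sub_nonneg.2 ?_
      gcongr
      exact h.incrementIntegral_equispaced_le hp z
    have hzero := (integral_eq_zero_iff_of_nonneg_ae hnn (i1.sub i0)).1 (by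
      refine le_antisymm ?_ (integral_nonneg_of_ae hnn)
      rw [integral_sub i1 i0]
      linarith)
    rw [EventuallyEq, ae_restrict_iff' measurableSet_Ioi] at hzero
    have hnull : volume (Ioo (ξ ((i : ℤ) + 1) - ξ i) 1) = 0 := by
      refine measure_mono_null (fun z hz => ?_) hzero
      have hz0 : 0 < z := hd0.trans_lt hz.1
      have hpos : 0 < z ^ (1 + s * p) := by positivity
      simp only [mem_compl_iff, mem_ofPred_eq, not_forall]
      refine ⟨hz0, (sub_pos.2 ?_).ne'⟩
      gcongr
      exact h.incrementIntegral_equispaced_lt hp hz0 hz.2 (Finset.mem_range.1 hi) hz.1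
    rw [Real.volume_Ioo, ENNReal.ofReal_eq_zero] at hnull
    linarith
  have hsum : ∑ i ∈ Finset.range T, (1 : ℝ) = ∑ i ∈ Finset.range T, (ξ ((i : ℤ) + 1) - ξ i) := by
    have := h.sum_gap 1
    push_cast at this
    rw [this]
    simp
  intro i hi
  exact ((Finset.sum_eq_sum_iff_of_le hge).1 hsum i (Finset.mem_range.2 hi)).symm

/-- When `z` is at least `δ` away from `k`, all hinges of the sum are on the same side of their
kink, so the sum depends only on the total of the gaps. -/
theorem gapSum_eq_of_near (h : IsEnumeration T ξ) {δ : ℝ}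
    (hδ : ∀ (n : ℤ) (k : ℕ), |ξ (n + k) - ξ n - k| ≤ δ) {z : ℝ} {k : ℕ} (hz : δ ≤ |z - k|) :
    gapSum T ξ z k = T * max (z - k) 0 := by
  rcases le_abs.1 hz with hz | hz
  · have hδ0 : 0 ≤ δ := (abs_nonneg _).trans (hδ 0 0)
    rw [max_eq_left (by linarith)]
    calc _ = ∑ i ∈ Finset.range T, (z - (ξ (i + k) - ξ i)) :=
          Finset.sum_congr rfl fun i _ => max_eq_left (by linarith [(abs_le.1 (hδ i k)).2])
      _ = _ := by
          rw [Finset.sum_sub_distrib, h.sum_gap]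
          simp [mul_sub]
  · have hδ0 : 0 ≤ δ := (abs_nonneg _).trans (hδ 0 0)
    rw [max_eq_right (by linarith), mul_zero]
    exact Finset.sum_eq_zero fun i _ => max_eq_right (by linarith [(abs_le.1 (hδ i k)).1])

theorem gapSum_le_of_near {δ : ℝ}
    (hδ : ∀ (n : ℤ) (k : ℕ), |ξ (n + k) - ξ n - k| ≤ δ) (z : ℝ) (k : ℕ) :
    gapSum T ξ z k ≤ T * max (z - k) 0 + T * δ := by
  have hδ0 : 0 ≤ δ := (abs_nonneg _).trans (hδ 0 0)
  calc _ ≤ ∑ i ∈ Finset.range T, (max (z - k) 0 + δ) := by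
        refine Finset.sum_le_sum fun i _ => max_le ?_ (by positivity)
        linarith [(abs_le.1 (hδ i k)).1, le_max_left (z - k) 0]
    _ = _ := by simp

theorem incrementIntegral_eq_of_near (h : IsEnumeration T ξ) (p : ℝ) {δ : ℝ}
    (hδ : ∀ (n : ℤ) (k : ℕ), |ξ (n + k) - ξ n - k| ≤ δ) {z : ℝ}
    (hz : ∀ k : ℕ, δ ≤ |z - (k + 1 : ℕ)|) :
    incrementIntegral T p ξ z = incrementIntegral T p (fun n : ℤ => (n : ℝ) + 0) z := by
  simp only [incrementIntegral, gapSum_intCast_add, fun k => h.gapSum_eq_of_near hδ (hz k)]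

/-- As `δ ≤ 1 / 4`, at most one positive integer is within `δ` of `z`. Only that term can change, by
at most `T * δ` times a second difference bounded by `2 * 2 ^ p`. -/
theorem incrementIntegral_le_of_near (h : IsEnumeration T ξ) {p : ℝ} (hp : 1 ≤ p) {δ : ℝ}
    (hδ : ∀ (n : ℤ) (k : ℕ), |ξ (n + k) - ξ n - k| ≤ δ) (hδ4 : δ ≤ 1 / 4) (z : ℝ) :
    incrementIntegral T p ξ z
      ≤ incrementIntegral T p (fun n : ℤ => (n : ℝ) + 0) z + 2 * 2 ^ p * (T * δ) := by
  have hδ0 : 0 ≤ δ := (abs_nonneg _).trans (hδ 0 0)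
  by_cases hz : ∀ k : ℕ, δ ≤ |z - (k + 1 : ℕ)|
  · rw [h.incrementIntegral_eq_of_near p hδ hz]
    have : 0 ≤ 2 * 2 ^ p * (T * δ) := by positivity
    linarith
  · push Not at hz
    obtain ⟨k₀, hk₀⟩ := hz
    have hB : 0 ≤ 2 * 2 ^ p * (T * δ) := by positivity
    have hterm : ∑ k ∈ Finset.range (⌈z⌉₊ + T), secondDiff p (z - (k + 1)) * gapSum T ξ z (k + 1)
        ≤ ∑ k ∈ Finset.range (⌈z⌉₊ + T), (secondDiff p (z - (k + 1))
          * gapSum T (fun n : ℤ => (n : ℝ) + 0) z (k + 1)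
          + if k = k₀ then 2 * 2 ^ p * (T * δ) else 0) := by
      refine Finset.sum_le_sum fun k _ => ?_
      rw [gapSum_intCast_add]
      by_cases hk : k = k₀
      · subst hk
        rw [if_pos rfl]
        have h1 : |z - (k + 1)| ≤ 1 := by
          push_cast at hk₀
          linarith
        have h2 := mul_le_mul_of_nonneg_left (gapSum_le_of_near (T := T) hδ z (k + 1))
          (secondDiff_nonneg hp (z - (k + 1)))
        have h3 := mul_le_mul_of_nonneg_right (secondDiff_le hp h1)
          (show (0 : ℝ) ≤ T * δ by positivity)
        linarith
      · rw [if_neg hk, add_zero, h.gapSum_eq_of_near hδ]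
        have h1 : (1 : ℝ) ≤ |((k + 1 : ℕ) : ℝ) - (k₀ + 1 : ℕ)| := by
          have : (1 : ℤ) ≤ |((k + 1 : ℕ) : ℤ) - (k₀ + 1 : ℕ)| :=
            Int.one_le_abs (by omega)
          exact_mod_cast this
        have h2 := abs_sub_le ((k + 1 : ℕ) : ℝ) z (k₀ + 1 : ℕ)
        rw [abs_sub_comm _ z] at h2
        linarith
    rw [Finset.sum_add_distrib, Finset.sum_ite_eq'] at hterm
    have : (if k₀ ∈ Finset.range (⌈z⌉₊ + T) then 2 * 2 ^ p * (T * δ) else 0)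
        ≤ 2 * 2 ^ p * (T * δ) := by
      split_ifs
      · exact le_rfl
      · exact hB
    unfold incrementIntegral
    linarith

end IsEnumeration

/-- Moving one point of an equispaced configuration changes the energy to higher than first order. -/
theorem hasDerivAt_jumpEnergy_update {T : ℕ} (hT : 0 < T) {s p : ℝ} (hp : 1 ≤ p) (hs0 : 0 < s)
    (hsp : s * p < 1) {x : Fin T → ℝ} {c : ℝ} (hx : ∀ i, x i = (i : ℕ) + c) (j : Fin T) :
    HasDerivAt (fun h : ℝ => (jumpEnergy T s p (Function.update x j (x j + h))).toReal) 0 0 := by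
  have : NeZero T := ⟨hT.ne'⟩
  set ξ : ℝ → ℤ → ℝ := fun h => periodicExtension (Function.update x j (x j + h)) with hξ
  have hval : ∀ (h : ℝ) (n : ℤ), ξ h n = n + c ∨ ξ h n = n + c + h := by
    intro h n
    obtain ⟨i, m, rfl⟩ := exists_eq_add_mul T n
    simp only [hξ, periodicExtension_add_mul]
    by_cases hij : i = j
    · subst hij
      right
      rw [Function.update_self, hx]
      push_cast
      ring
    · left
      rw [Function.update_of_ne hij, hx]
      push_cast
      ring
  have hnear : ∀ (h : ℝ) (n : ℤ) (k : ℕ), |ξ h (n + k) - ξ h n - k| ≤ |h| := by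
    intro h n k
    rcases hval h n with e1 | e1 <;> rcases hval h (n + k) with e2 | e2 <;> rw [e1, e2] <;>
      push_cast
    · rw [show (n + k + c - (n + c) - k : ℝ) = 0 by ring, abs_zero]
      exact abs_nonneg h
    · rw [show (n + k + c + h - (n + c) - k : ℝ) = h by ring]
    · rw [show (n + k + c - (n + c + h) - k : ℝ) = -h by ring, abs_neg]
    · rw [show (n + k + c + h - (n + c + h) - k : ℝ) = 0 by ring, abs_zero]
      exact abs_nonneg h
  -- Consecutive points stay at distance at least `1 - |h|`, so the moved tuple remains ordered
  -- without relabelling.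
  have henum : ∀ h : ℝ, |h| ≤ 1 / 4 → IsEnumeration T (ξ h) := by
    intro h hh
    refine ⟨monotone_int_of_le_succ fun n => ?_, fun n => ?_⟩
    · have := (abs_le.1 (hnear h n 1)).1
      push_cast at this
      linarith
    · obtain ⟨i, m, rfl⟩ := exists_eq_add_mul T n
      simp only [hξ, show ((i : ℕ) : ℤ) + m * T + T = (i : ℕ) + (m + 1) * T by ring,
        periodicExtension_add_mul]
      push_cast
      ring
  set Φ : ℝ → ℝ → ℝ := fun h z => incrementIntegral T p (ξ h) z / z ^ (1 + s * p) with hΦ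
  set Φ₀ : ℝ → ℝ := fun z => incrementIntegral T p (fun n : ℤ => (n : ℝ) + 0) z / z ^ (1 + s * p)
    with hΦ₀
  have hΦi : ∀ h, |h| ≤ 1 / 4 → IntegrableOn (Φ h) (Ioi 0) := fun h hh =>
    (henum h hh).integrableOn_incrementIntegral hT hp hs0 hsp
  have hΦ₀i : IntegrableOn Φ₀ (Ioi 0) :=
    (isEnumeration_intCast_add T 0).integrableOn_incrementIntegral hT hp hs0 hsp
  have hE : ∀ h, |h| ≤ 1 / 4 → (jumpEnergy T s p (Function.update x j (x j + h))).toReal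
      = 2 * ∫ z in Ioi 0, Φ h z := fun h hh =>
    (henum h hh).toReal_jumpEnergy hT hp hs0 hsp (enumerates_periodicExtension _)
  have h00 : |(0 : ℝ)| ≤ 1 / 4 := by norm_num
  have hΦ0 : Φ 0 = Φ₀ := by
    funext z
    simp only [hΦ, hΦ₀]
    rw [(henum 0 h00).incrementIntegral_eq_of_near p (δ := 0)
      (fun n k => by simpa using hnear 0 n k) fun k => abs_nonneg _]
  have hev : ∀ᶠ h in 𝓝[≠] (0 : ℝ), |h| ≤ 1 / 4 := by
    refine nhdsWithin_le_nhds ?_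
    filter_upwards [Metric.ball_mem_nhds (0 : ℝ) (show (0 : ℝ) < 1 / 4 by norm_num)] with h hh
    simpa using (mem_ball_zero_iff.1 hh).le
  -- Dominated convergence for the difference quotients. The bound vanishes on `z ≤ 1 / 2`, where no
  -- positive integer is within `|h| ≤ 1 / 4`; this removes the singularity at zero.
  have hlim : Tendsto (fun h => ∫ z in Ioi 0, h⁻¹ * (Φ h z - Φ₀ z)) (𝓝[≠] (0 : ℝ))
      (𝓝 (∫ _z in Ioi (0 : ℝ), (0 : ℝ))) := by
    refine tendsto_integral_filter_of_dominated_convergence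
      ((Ioi (1 / 2 : ℝ)).indicator fun z => 2 * 2 ^ p * T * z ^ (-(1 + s * p))) ?_ ?_ ?_ ?_
    · filter_upwards [hev] with h hh
      exact ((hΦi h hh).sub hΦ₀i).1.const_mul _
    · filter_upwards [hev, self_mem_nhdsWithin] with h hh hh0
      have hh0' : 0 < |h| := abs_pos.2 hh0
      filter_upwards [ae_restrict_mem measurableSet_Ioi] with z hz
      have hz' : 0 < z := hz
      have hle := (henum h hh).incrementIntegral_equispaced_le hp z
      rw [norm_mul, norm_inv, Real.norm_eq_abs, Real.norm_eq_abs, inv_mul_le_iff₀ hh0',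
        abs_of_nonneg (by
          refine sub_nonneg.2 ?_
          simp only [hΦ, hΦ₀]
          gcongr), ← sub_div, div_le_iff₀ (by positivity)]
      by_cases hz2 : z ∈ Ioi (1 / 2 : ℝ)
      · rw [indicator_of_mem hz2, mul_assoc |h|, mul_assoc _ (z ^ _), ← Real.rpow_add hz',
          neg_add_cancel, Real.rpow_zero, mul_one]
        linarith [(henum h hh).incrementIntegral_le_of_near hp (hnear h) hh z]
      · rw [indicator_of_notMem hz2, (henum h hh).incrementIntegral_eq_of_near p (hnear h)]
        · simp
        · intro k
          rw [mem_Ioi, not_lt] at hz2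
          have : (1 : ℝ) ≤ (k + 1 : ℕ) := by exact_mod_cast Nat.succ_pos k
          rw [abs_of_nonpos (show z - (k + 1 : ℕ) ≤ 0 by linarith)]
          linarith
    · refine Integrable.integrableOn ?_
      rw [integrable_indicator_iff measurableSet_Ioi]
      exact (integrableOn_Ioi_rpow_of_lt (by nlinarith) (by norm_num)).const_mul _
    -- For noninteger `z` the quotient is exactly zero once `|h|` is at most the distance from `z`
    -- to the integers.
    · have hnull : ∀ᵐ z : ℝ, z ∉ range (fun n : ℤ => (n : ℝ)) :=
        (countable_range _).ae_notMem volume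
      filter_upwards [ae_restrict_of_ae hnull] with z hz
      have hpos : 0 < |z - round z| := by
        rw [abs_pos, sub_ne_zero]
        exact fun e => hz ⟨round z, e.symm⟩
      refine tendsto_const_nhds.congr' ?_
      have hsmall : ∀ᶠ h in 𝓝[≠] (0 : ℝ), |h| ≤ |z - round z| := by
        refine nhdsWithin_le_nhds ?_
        filter_upwards [Metric.ball_mem_nhds (0 : ℝ) hpos] with h hh
        simpa using (mem_ball_zero_iff.1 hh).le
      filter_upwards [hev, hsmall] with h hh hhz
      simp only [hΦ, hΦ₀]
      rw [(henum h hh).incrementIntegral_eq_of_near p (hnear h), sub_self, mul_zero]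
      intro k
      have := round_le z ((k + 1 : ℕ) : ℤ)
      rw [Int.cast_natCast] at this
      exact hhz.trans this
  rw [hasDerivAt_iff_tendsto_slope_zero]
  rw [integral_zero] at hlim
  have hlim2 := hlim.const_mul 2
  rw [mul_zero] at hlim2
  refine hlim2.congr' ?_
  filter_upwards [hev] with h hh
  rw [zero_add, hE h hh, hE 0 h00, hΦ0, integral_const_mul, integral_sub (hΦi h hh) hΦ₀i,
    smul_eq_mul]
  ring

/-! ### Configurations: minimisers and critical points. -/

namespace Config

variable {T : ℕ}

theorem pts_mem_orderedTuples (X : Config T) : X.pts ∈ orderedTuples T :=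
  ⟨X.mono, fun i j => by linarith [(X.mem_Ico i).2, (X.mem_Ico j).1]⟩

theorem enumerates_of_isTranslateOf {X : Config T} (hX : X.IsTranslateOf (equispaced T)) :
    ∃ a : ℝ, Enumerates T (fun n : ℤ => (n : ℝ) + a) X.pts := by
  obtain ⟨a, σ, k, h⟩ := hX
  exact ⟨a, σ, k, fun i => by rw [h]; simp [equispaced]⟩

theorem toReal_energy_eq (hT : 0 < T) [NeZero T] {s p : ℝ} (hp : 1 ≤ p) (hs0 : 0 < s)
    (hsp : s * p < 1) (X : Config T) :
    (X.energy s p).toReal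
      = 2 * ∫ z in Ioi 0, incrementIntegral T p (periodicExtension X.pts) z / z ^ (1 + s * p) :=
  (isEnumeration_periodicExtension X.pts_mem_orderedTuples).toReal_jumpEnergy hT hp hs0 hsp
    (enumerates_periodicExtension X.pts)

theorem toReal_energy_of_isTranslateOf (hT : 0 < T) {s p : ℝ} (hp : 1 ≤ p) (hs0 : 0 < s)
    (hsp : s * p < 1) {X : Config T} (hX : X.IsTranslateOf (equispaced T)) :
    (X.energy s p).toReal = 2 * ∫ z in Ioi 0,
      incrementIntegral T p (fun n : ℤ => (n : ℝ) + 0) z / z ^ (1 + s * p) := by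
  obtain ⟨a, ha⟩ := enumerates_of_isTranslateOf hX
  rw [energy, (isEnumeration_intCast_add T a).toReal_jumpEnergy hT hp hs0 hsp ha]
  simp only [incrementIntegral_intCast_add T p a]

theorem equispaced_isTranslateOf (T : ℕ) : (equispaced T).IsTranslateOf (equispaced T) :=
  ⟨0, 1, 0, by simp⟩

theorem energy_le_iff (hT : 0 < T) {s p : ℝ} (hp : 1 ≤ p) (hs0 : 0 < s) (hsp : s * p < 1)
    (X Y : Config T) : X.energy s p ≤ Y.energy s p ↔ (X.energy s p).toReal ≤ (Y.energy s p).toReal :=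
  (ENNReal.toReal_le_toReal (jumpEnergy_ne_top hT hp hs0 hsp _)
    (jumpEnergy_ne_top hT hp hs0 hsp _)).symm

theorem isGlobalMinimiser_of_isTranslateOf (hT : 0 < T) {s p : ℝ} (hp : 1 ≤ p) (hs0 : 0 < s)
    (hsp : s * p < 1) {X : Config T} (hX : X.IsTranslateOf (equispaced T)) :
    X.IsGlobalMinimiser s p := by
  intro Y
  have : NeZero T := ⟨hT.ne'⟩
  have hY := isEnumeration_periodicExtension Y.pts_mem_orderedTuples
  rw [energy_le_iff hT hp hs0 hsp, toReal_energy_of_isTranslateOf hT hp hs0 hsp hX,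
    toReal_energy_eq hT hp hs0 hsp]
  refine mul_le_mul_of_nonneg_left (setIntegral_mono_on
    ((isEnumeration_intCast_add T 0).integrableOn_incrementIntegral hT hp hs0 hsp)
    (hY.integrableOn_incrementIntegral hT hp hs0 hsp) measurableSet_Ioi fun z hz => ?_) zero_le_two
  have hz' : 0 < z := hz
  gcongr
  exact hY.incrementIntegral_equispaced_le hp z

theorem IsGlobalMinimiser.exists_pts_eq (hT : 0 < T) {s p : ℝ} (hp : 1 ≤ p) (hs0 : 0 < s)
    (hsp : s * p < 1) {X : Config T} (hX : X.IsGlobalMinimiser s p) :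
    ∃ c : ℝ, ∀ i, X.pts i = (i : ℕ) + c := by
  have : NeZero T := ⟨hT.ne'⟩
  have hle := hX (equispaced T)
  rw [energy_le_iff hT hp hs0 hsp, toReal_energy_of_isTranslateOf hT hp hs0 hsp
    (equispaced_isTranslateOf T), toReal_energy_eq hT hp hs0 hsp] at hle
  have hgap := (isEnumeration_periodicExtension X.pts_mem_orderedTuples).gap_eq_one_of_integral_le
    hT hp hs0 hsp (le_of_mul_le_mul_left hle two_pos)
  have hind : ∀ n : ℕ, n < T → periodicExtension X.pts n = n + periodicExtension X.pts 0 := by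
    intro n
    induction n with
    | zero => simp
    | succ n ih =>
      intro hn
      have h1 := hgap n (by omega)
      have h2 := ih (by omega)
      push_cast
      linarith
  exact ⟨periodicExtension X.pts 0, fun i => by
    rw [← periodicExtension_coe X.pts, hind i i.isLt]⟩

theorem isTranslateOf_of_pts_eq {X : Config T} {c : ℝ} (hX : ∀ i, X.pts i = (i : ℕ) + c) :
    X.IsTranslateOf (equispaced T) :=
  ⟨c, 1, 0, fun i => by simp [hX, equispaced]⟩

theorem isRegular_of_pts_eq {X : Config T} {c : ℝ} (hX : ∀ i, X.pts i = (i : ℕ) + c) :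
    X.IsRegular := by
  refine ⟨1, one_pos, le_rfl, fun i j k hijk => ?_⟩
  have e : X.pts i - (X.pts j + k * T) = ((((i : ℕ) : ℤ) - ((j : ℕ) + k * T) : ℤ) : ℝ) := by
    rw [hX, hX]
    push_cast
    ring
  rw [e, ← Int.cast_abs, ← Int.cast_one, Int.cast_le]
  refine Int.one_le_abs fun h0 => ?_
  have hi := i.isLt
  have hj := j.isLt
  have hk : k = 0 := by
    rcases lt_trichotomy k 0 with hk | hk | hk
    · nlinarith [show k ≤ -1 by omega, show (0 : ℤ) < T by omega]
    · exact hk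
    · nlinarith [show 1 ≤ k by omega, show (0 : ℤ) < T by omega]
  subst hk
  rcases hijk with h | h
  · exact h (Fin.ext (by omega))
  · exact h rfl

/-- A single point displaced by less than the minimal distance `l` cannot pass its neighbours,
including those across the period. -/
theorem IsRegular.exists_update_mem {X : Config T} (hX : X.IsRegular) :
    ∃ δ : ℝ, 0 < δ ∧ ∀ i h, |h| < δ →
      Function.update X.pts i (X.pts i + h) ∈ orderedTuples T := by
  obtain ⟨l, hl0, -, hl⟩ := hX
  refine ⟨l, hl0, fun i h hh => ?_⟩
  have hh' := abs_lt.1 hh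
  have hlt : ∀ a b : Fin T, a < b → X.pts a + l ≤ X.pts b := by
    intro a b hab
    have h1 := hl a b 0 (Or.inl hab.ne)
    have h2 := X.mono hab.le
    rw [Int.cast_zero, zero_mul, add_zero, abs_of_nonpos (by linarith)] at h1
    linarith
  have hper : ∀ a b : Fin T, a ≠ b → X.pts a + l ≤ X.pts b + T := by
    intro a b hab
    have h1 := hl a b 1 (Or.inl hab)
    have h2 := (X.pts_mem_orderedTuples).2 a b
    rw [Int.cast_one, one_mul, abs_of_nonpos (by linarith)] at h1
    linarith
  refine ⟨fun a b hab => ?_, fun a b => ?_⟩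
  · rcases hab.eq_or_lt with rfl | hab
    · exact le_rfl
    have := hlt a b hab
    simp only [Function.update_apply]
    split_ifs with ha hb hb
    · exact absurd (ha.trans hb.symm) hab.ne
    · rw [← ha]
      linarith
    · rw [← hb]
      linarith
    · linarith
  · by_cases hab : a = b
    · subst hab
      simp
    have := hper a b hab
    simp only [Function.update_apply]
    split_ifs with ha hb hb
    · exact absurd (ha.trans hb.symm) hab
    · rw [← ha]
      linarith
    · rw [← hb]
      linarith
    · linarith

theorem isGlobalMinimiser_of_isCritical (hT : 0 < T) {s p : ℝ} (hp : 1 ≤ p) (hs0 : 0 < s)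
    (hsp : s * p < 1) {X : Config T} (hreg : X.IsRegular) (hcrit : X.IsCritical s p) :
    X.IsGlobalMinimiser s p := by
  have : NeZero T := ⟨hT.ne'⟩
  obtain ⟨δ, hδ, hmem⟩ := hreg.exists_update_mem
  intro Y
  rw [energy_le_iff hT hp hs0 hsp]
  exact (convexOn_jumpEnergy hT hp hs0 hsp).le_of_partialDeriv_eq_zero Y.pts_mem_orderedTuples hδ
    hmem hcrit

/-- Interpolating the sorted representatives of `X` and `Y` gives a configuration `Z` near `X`, and
convexity turns `E X ≤ E Z ≤ (1 - t) * E X + t * E Y` into `E X ≤ E Y`. -/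
theorem IsLocalMinimiser.isGlobalMinimiser (hT : 0 < T) {s p : ℝ} (hp : 1 ≤ p) (hs0 : 0 < s)
    (hsp : s * p < 1) {X : Config T} (hX : X.IsLocalMinimiser s p) : X.IsGlobalMinimiser s p := by
  obtain ⟨ε, hε, hloc⟩ := hX
  have hT' : (0 : ℝ) < T := by exact_mod_cast hT
  intro Y
  -- Points of both configurations lie in `[0, T)`, so `Z` displaces each by at most `t * T < ε`.
  set t : ℝ := min 1 (ε / (2 * T)) with ht
  have ht0 : 0 < t := lt_min one_pos (by positivity)
  have ht1 : t ≤ 1 := min_le_left _ _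
  have htT : t * T < ε := by
    have h1 : t * T ≤ ε / (2 * T) * T := mul_le_mul_of_nonneg_right (min_le_right _ _) hT'.le
    have h2 : ε / (2 * T) * T = ε / 2 := by field_simp
    linarith
  let Z : Config T :=
    { pts := (1 - t) • X.pts + t • Y.pts
      mem_Ico := fun i => (convex_Ico (0 : ℝ) T) (X.mem_Ico i) (Y.mem_Ico i) (by linarith) ht0.le
        (by ring)
      mono := (convex_orderedTuples T X.pts_mem_orderedTuples Y.pts_mem_orderedTuples
        (by linarith) ht0.le (by ring)).1 }
  have hZ : X.IsNear ε Z := by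
    refine ⟨1, 0, fun i => lt_of_le_of_lt ?_ htT⟩
    have e : Z.pts ((1 : Equiv.Perm (Fin T)) i) + ((0 : Fin T → ℤ) i : ℝ) * T - X.pts i
        = t * (Y.pts i - X.pts i) := by
      simp only [Z, Equiv.Perm.coe_one, id_eq, Pi.add_apply, Pi.smul_apply, smul_eq_mul,
        Pi.zero_apply, Int.cast_zero]
      ring
    rw [e, abs_mul, abs_of_pos ht0]
    gcongr
    rw [abs_le]
    constructor <;> linarith [(X.mem_Ico i).1, (X.mem_Ico i).2, (Y.mem_Ico i).1, (Y.mem_Ico i).2]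
  have h1 := hloc Z hZ
  rw [energy_le_iff hT hp hs0 hsp] at h1 ⊢
  have h2 := (convexOn_jumpEnergy hT hp hs0 hsp).2 X.pts_mem_orderedTuples Y.pts_mem_orderedTuples
    (show 0 ≤ 1 - t by linarith) ht0.le (by ring)
  change (Z.energy s p).toReal ≤ (1 - t) * (X.energy s p).toReal + t * (Y.energy s p).toReal at h2
  refine le_of_mul_le_mul_left ?_ ht0
  linarith

theorem isGlobalMinimiser_iff_isTranslateOf (hT : 0 < T) {s p : ℝ} (hp : 1 ≤ p) (hs0 : 0 < s)
    (hsp : s * p < 1) (X : Config T) :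
    X.IsGlobalMinimiser s p ↔ X.IsTranslateOf (equispaced T) := by
  refine ⟨fun h => ?_, isGlobalMinimiser_of_isTranslateOf hT hp hs0 hsp⟩
  obtain ⟨c, hc⟩ := h.exists_pts_eq hT hp hs0 hsp
  exact isTranslateOf_of_pts_eq hc

/-- Going through global minimality puts the sorted points in the form `i + c`, which disposes of
the permutation and the multiples of `T` in `IsTranslateOf`. -/
theorem isRegular_and_isCritical_of_isTranslateOf (hT : 0 < T) {s p : ℝ} (hp : 1 ≤ p)
    (hs0 : 0 < s) (hsp : s * p < 1) {X : Config T} (hX : X.IsTranslateOf (equispaced T)) :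
    X.IsRegular ∧ X.IsCritical s p := by
  obtain ⟨c, hc⟩ := (isGlobalMinimiser_of_isTranslateOf hT hp hs0 hsp hX).exists_pts_eq
    hT hp hs0 hsp
  exact ⟨isRegular_of_pts_eq hc, fun i => hasDerivAt_jumpEnergy_update hT hp hs0 hsp hc i⟩

end Config

theorem mainTheorem3 (T : ℕ) (hT : 0 < T) (s p : ℝ) (hp : 1 ≤ p) (hs0 : 0 < s) (hs1 : s < 1)
    (hsp : s * p < 1) :
    (∀ x : Fin T → ℝ, jumpEnergy T s p x ≠ ⊤) ∧
    (∀ X : Config T,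
      (X.IsRegular ∧ X.IsCritical s p) ↔ X.IsTranslateOf (Config.equispaced T)) ∧
    (∀ X : Config T, X.IsLocalMinimiser s p ↔ X.IsTranslateOf (Config.equispaced T)) ∧
    (∀ X : Config T, X.IsGlobalMinimiser s p ↔ X.IsTranslateOf (Config.equispaced T)) := by
  have hglob := Config.isGlobalMinimiser_iff_isTranslateOf hT hp hs0 hsp
  refine ⟨jumpEnergy_ne_top hT hp hs0 hsp, fun X => ⟨fun h => ?_, fun h => ?_⟩,
    fun X => ⟨fun h => ?_, fun h => ?_⟩, hglob⟩
  · exact (hglob X).1 (Config.isGlobalMinimiser_of_isCritical hT hp hs0 hsp h.1 h.2)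
  · exact Config.isRegular_and_isCritical_of_isTranslateOf hT hp hs0 hsp h
  · exact (hglob X).1 (h.isGlobalMinimiser hT hp hs0 hsp)
  · exact ⟨1, one_pos, fun Y _ => (hglob X).2 h Y⟩

end
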